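/- Let $\mathcal V$ be a cofibrantly generated closed symmetric monoidal model category: $\mathcal V$ is complete and cocomplete, closed symmetric monoidal with unit $\mathsf I$, carries a cofibrantly generated model structure, satisfies the pushout-product axiom, and for every weak equivalence $Q\to\mathsf I$ with $Q$ cofibrant and every cofibrant $K$ the map $Q\otimes K\to\mathsf I\otimes K\cong K$ is a weak equivalence. An object $K\in\mathcal V$ is $\mathcal V$-flat if $K\otimes-$ preserves cofibrations and trivial cofibrations; a small $\mathcal V$-category is locally $\mathcal V$-flat if all its hom-objects are $\mathcal V$-flat. For a small locally $\mathcal V$-flat $\mathcal V$-category $\mathcal C$, the category $[\mathcal C^{\mathrm{op}},\mathcal V]$ of $\mathcal V$-functors and $\mathcal V$-natural transformations is equipped with the projective model structure: weak equivalences and fibrations are pointwise, and cofibrations are the maps with the left lifting property with respect to trivial fibrations. Let $F\colon\mathcal D\to\mathcal C$ be a $\mathcal V$-functor between small locally $\mathcal V$-flat $\mathcal V$-categories, let $F^*\colon[\mathcal C^{\mathrm{op}},\mathcal V]\to[\mathcal D^{\mathrm{op}},\mathcal V]$ be restriction along $F$, and let $F_!$ be its left adjoint. **Theorem.** The adjunction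 $F_!\dashv F^*$ is a Quillen equivalence if and only if both of the following hold: 1. $F$ is homotopically full and faithful, i.e. $\mathcal D(d',d)\to\mathcal C(Fd',Fd)$ is a weak equivalence in $\mathcal V$ for all $d',d\in\mathcal D$; 2. every object $c\in\mathcal C$ is a homotopy absolute homotopy weighted colimit of $F$, i.e. there is a weight $W\in[\mathcal D^{\mathrm{op}},\mathcal V]$, cofibrant in the projective model structure, such that the weighted colimit $W\star_{\mathcal D}y_{\mathcal C}F$, formed in the $\mathcal V$-category $[\mathcal C^{\mathrm{op}},\mathcal V]$ with $y_{\mathcal C}$ the Yoneda embedding, is weakly equivalent (connected by a zigzag of pointwise weak equivalences) to the representable presheaf $\mathcal C^c=\mathcal C(-,c)$. -/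

import Mathlib

open CategoryTheory MonoidalCategory Limits HomotopicalAlgebra

universe w v u

noncomputable section

/-! ### Monoidal model categories -/

section MonoidalModel

variable {V : Type u} [Category.{v} V]

/-- `A` is small relative to the class of morphisms `S`: there is a cardinal `κ` such that, for
every regular cardinal `μ ≥ κ`, the functor `Hom(A, -)` preserves the colimits of all
`μ`-sequences whose successor maps lie in `S`. -/
def IsSmallRelativeTo (A : V) (S : MorphismProperty V) : Prop :=
  ∃ κ : Cardinal.{v}, ∀ μ : Cardinal.{v}, κ ≤ μ → ∀ (_ : Fact μ.IsRegular)
    (_ : OrderBot μ.ord.ToType) (_ : SuccOrder μ.ord.ToType) (X Y : V) (f : X ⟶ Y)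
    (h : S.TransfiniteCompositionOfShape μ.ord.ToType f),
    PreservesColimit h.F (coyoneda.obj (Opposite.op A))

/-- A model category is cofibrantly generated if there are (small) sets `I` and `J` of morphisms
which detect the trivial fibrations and the fibrations respectively, and whose domains are small
relative to the cofibrations, respectively the trivial cofibrations. -/
def IsCofibrantlyGenerated (V : Type u) [Category.{v} V] [ModelCategory V] : Prop :=
  ∃ I J : MorphismProperty V,
    MorphismProperty.IsSmall.{v} I ∧ MorphismProperty.IsSmall.{v} J ∧
    trivialFibrations V = I.rlp ∧ fibrations V = J.rlp ∧
    (∀ ⦃A B : V⦄ (i : A ⟶ B), I i → IsSmallRelativeTo A (cofibrations V)) ∧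
    (∀ ⦃A B : V⦄ (j : A ⟶ B), J j → IsSmallRelativeTo A (trivialCofibrations V))

/-- The pushout-product `A ⊗ Y ⊔_{A ⊗ X} B ⊗ X ⟶ B ⊗ Y` of `f : A ⟶ B` and `g : X ⟶ Y`. -/
abbrev pushoutProductMap [MonoidalCategory V] [HasPushouts V] {A B X Y : V}
    (f : A ⟶ B) (g : X ⟶ Y) :=
  ((MonoidalCategory.Arrow.pushoutProduct.obj (Arrow.mk f)).obj (Arrow.mk g)).hom

/-- The compatibility axioms between a model structure and a symmetric monoidal structure: the
pushout-product axiom and the unit axiom. -/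
class IsMonoidalModelCategory (V : Type u) [Category.{v} V] [MonoidalCategory V]
    [ModelCategory V] : Prop where
  cofibration_pushoutProduct {A B X Y : V} (f : A ⟶ B) (g : X ⟶ Y) [Cofibration f]
    [Cofibration g] : Cofibration (pushoutProductMap f g)
  weakEquivalence_pushoutProduct_left {A B X Y : V} (f : A ⟶ B) (g : X ⟶ Y) [Cofibration f]
    [Cofibration g] [WeakEquivalence f] : WeakEquivalence (pushoutProductMap f g)
  weakEquivalence_pushoutProduct_right {A B X Y : V} (f : A ⟶ B) (g : X ⟶ Y) [Cofibration f]
    [Cofibration g] [WeakEquivalence g] : WeakEquivalence (pushoutProductMap f g)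
  weakEquivalence_unit {Q K : V} (q : Q ⟶ 𝟙_ V) [IsCofibrant Q] [WeakEquivalence q]
    [IsCofibrant K] : WeakEquivalence (q ▷ K)

/-- `K` is flat if `K ⊗ -` preserves cofibrations and trivial cofibrations. -/
def IsFlatObject [MonoidalCategory V] [ModelCategory V] (K : V) : Prop :=
  ∀ ⦃X Y : V⦄ (f : X ⟶ Y), Cofibration f →
    Cofibration (K ◁ f) ∧ (WeakEquivalence f → WeakEquivalence (K ◁ f))

/-- A `V`-category is locally flat if all its hom-objects are flat. -/
def IsLocallyFlat (V : Type u) [Category.{v} V] [MonoidalCategory V] [ModelCategory V]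
    (C : Type w) [EnrichedCategory V C] : Prop :=
  ∀ a b : C, IsFlatObject (a ⟶[V] b)

end MonoidalModel

/-! ### Quillen equivalences and weakly equivalent objects -/

section Quillen

variable {A : Type*} [Category* A] {B : Type*} [Category* B]

/-- `adj : L ⊣ R` is a Quillen equivalence: it is a Quillen adjunction, and for `X` cofibrant and
`Y` fibrant a map `L X ⟶ Y` is a weak equivalence iff its transpose `X ⟶ R Y` is. -/
structure IsQuillenEquivalence
    [CategoryWithFibrations A] [CategoryWithCofibrations A] [CategoryWithWeakEquivalences A]
    [CategoryWithFibrations B] [CategoryWithCofibrations B] [CategoryWithWeakEquivalences B]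
    [HasInitial A] [HasTerminal B] {L : A ⥤ B} {R : B ⥤ A} (adj : L ⊣ R) : Prop where
  map_cofibration {X Y : A} (f : X ⟶ Y) : Cofibration f → Cofibration (L.map f)
  map_trivialCofibration {X Y : A} (f : X ⟶ Y) : Cofibration f → WeakEquivalence f →
    Cofibration (L.map f) ∧ WeakEquivalence (L.map f)
  weakEquivalence_iff (X : A) (Y : B) (f : L.obj X ⟶ Y) : IsCofibrant X → IsFibrant Y →
    (WeakEquivalence f ↔ WeakEquivalence (adj.homEquiv X Y f))

/-- Two objects are weakly equivalent if a zigzag of weak equivalences connects them. -/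
def WeaklyEquivalent [CategoryWithWeakEquivalences A] (X Y : A) : Prop :=
  Relation.EqvGen (fun X' Y' : A ↦ ∃ f : X' ⟶ Y', WeakEquivalence f) X Y

end Quillen

/-! ### Enriched presheaves -/

/-- A `V`-functor `Cᵒᵖ → V`, with its action on hom-objects `C(a, b) → V(X b, X a)` written in
transposed form `C(a, b) ⊗ X b → X a`. -/
structure VPresheaf (V : Type u) [Category.{v} V] [MonoidalCategory V]
    (C : Type w) [EnrichedCategory V C] where
  obj : C → V
  act (a b : C) : (a ⟶[V] b) ⊗ obj b ⟶ obj a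
  act_id (a : C) : eId V a ▷ obj a ≫ act a a = (λ_ (obj a)).hom
  act_comp (a b c : C) : eComp V a b c ▷ obj c ≫ act a c =
    (α_ _ _ _).hom ≫ (a ⟶[V] b) ◁ act b c ≫ act a b

namespace VPresheaf

section Basic

variable {V : Type u} [Category.{v} V] [MonoidalCategory V]
variable {C : Type w} [EnrichedCategory V C]

attribute [simp] act_id act_comp

/-- A `V`-natural transformation. -/
@[ext]
structure Hom (X Y : VPresheaf V C) where
  app (a : C) : X.obj a ⟶ Y.obj a
  naturality (a b : C) : X.act a b ≫ app a = (a ⟶[V] b) ◁ app b ≫ Y.act a b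

attribute [simp] Hom.naturality

@[simp]
theorem Hom.naturality_assoc {X Y : VPresheaf V C} (f : Hom X Y) (a b : C) {Z : V}
    (h : Y.obj a ⟶ Z) :
    X.act a b ≫ f.app a ≫ h = (a ⟶[V] b) ◁ f.app b ≫ Y.act a b ≫ h := by
  rw [← Category.assoc, f.naturality, Category.assoc]

/-- The underlying ordinary category of `[Cᵒᵖ, V]`. -/
instance : Category (VPresheaf V C) where
  Hom X Y := Hom X Y
  id X := { app a := 𝟙 _, naturality a b := by simp }
  comp f g := { app a := f.app a ≫ g.app a, naturality a b := by simp }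

@[ext]
theorem hom_ext {X Y : VPresheaf V C} {f g : X ⟶ Y} (h : ∀ a, f.app a = g.app a) : f = g :=
  Hom.ext (funext h)

@[simp] theorem id_app (X : VPresheaf V C) (a : C) : Hom.app (𝟙 X) a = 𝟙 (X.obj a) := rfl

@[simp] theorem comp_app {X Y Z : VPresheaf V C} (f : X ⟶ Y) (g : Y ⟶ Z) (a : C) :
    (f ≫ g).app a = f.app a ≫ g.app a := rfl

/-- The representable presheaf `C(-, c)`. -/
abbrev representable (c : C) : VPresheaf V C where
  obj a := a ⟶[V] c
  act a b := eComp V a b c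
  act_id a := by
    rw [← cancel_epi (λ_ _).inv, e_id_comp, Iso.inv_hom_id]
  act_comp a b c' := (e_assoc' V a b c' c).symm

/-- Restriction along a `V`-functor: `F^* X = X ∘ F`. -/
abbrev restrict {D : Type*} [EnrichedCategory V D] (F : EnrichedFunctor V D C)
    (X : VPresheaf V C) : VPresheaf V D where
  obj d := X.obj (F.obj d)
  act d e := F.map d e ▷ _ ≫ X.act _ _
  act_id d := by
    rw [← comp_whiskerRight_assoc, F.map_id, act_id]
  act_comp d e f := by
    rw [← comp_whiskerRight_assoc, F.map_comp, comp_whiskerRight_assoc, act_comp]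
    simp [MonoidalCategory.tensorHom_def', whisker_exchange_assoc]

/-- The action of `F^*` on `V`-natural transformations. -/
abbrev restrictMap {D : Type*} [EnrichedCategory V D] (F : EnrichedFunctor V D C)
    {X Y : VPresheaf V C} (f : X ⟶ Y) : restrict F X ⟶ restrict F Y where
  app d := f.app (F.obj d)
  naturality d e := by simp [restrict, whisker_exchange_assoc]

/-- The functor `F^* : [Cᵒᵖ, V] → [Dᵒᵖ, V]`. -/
def restriction {D : Type*} [EnrichedCategory V D] (F : EnrichedFunctor V D C) :
    VPresheaf V C ⥤ VPresheaf V D where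
  obj X := restrict F X
  map f := restrictMap F f

theorem act_act_of_hom {D : Type*} [EnrichedCategory V D] {F : EnrichedFunctor V D C}
    {W : VPresheaf V D} {X : VPresheaf V C} (g : W ⟶ restrict F X) (c : C)
    (d e : D) :
    (c ⟶[V] F.obj d) ◁ F.map d e ▷ W.obj e ≫ (α_ _ _ _).inv ≫
      eComp V _ _ _ ▷ W.obj e ≫ (c ⟶[V] F.obj e) ◁ g.app e ≫ X.act c (F.obj e) =
      (c ⟶[V] F.obj d) ◁ W.act d e ≫ (c ⟶[V] F.obj d) ◁ g.app d ≫ X.act c (F.obj d) := by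
  have h : W.act d e ≫ g.app d =
      (d ⟶[V] e) ◁ g.app e ≫ F.map d e ▷ X.obj (F.obj e) ≫ X.act (F.obj d) (F.obj e) :=
    g.naturality d e
  rw [← MonoidalCategory.whiskerLeft_comp_assoc _ (W.act d e), h, ← whisker_exchange_assoc,
    act_comp, whisker_exchange_assoc]
  simp

end Basic

/-! #### The `V`-category of presheaves -/

section HomObject

variable {V : Type u} [Category.{v} V] [MonoidalCategory V] [MonoidalClosed V]
  [HasLimitsOfSize.{v, v} V]
variable {C : Type v} [EnrichedCategory V C]

/-- The two maps whose equalizer is the object of `V`-natural transformations: a family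
`(f a : V(X a, Y a))` is sent to the families `f a ∘ X.act a b` and `Y.act a b ∘ (C(a, b) ⊗ f b)`. -/
def homMapLeft (X Y : VPresheaf V C) :
    (∏ᶜ fun a : C ↦ (ihom (X.obj a)).obj (Y.obj a)) ⟶
      ∏ᶜ fun p : C × C ↦ (ihom ((p.1 ⟶[V] p.2) ⊗ X.obj p.2)).obj (Y.obj p.1) :=
  Pi.lift fun p ↦ Pi.π _ p.1 ≫ (MonoidalClosed.pre (X.act p.1 p.2)).app (Y.obj p.1)

/-- The second of the two maps described for `homMapLeft`. -/
def homMapRight (X Y : VPresheaf V C) :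
    (∏ᶜ fun a : C ↦ (ihom (X.obj a)).obj (Y.obj a)) ⟶
      ∏ᶜ fun p : C × C ↦ (ihom ((p.1 ⟶[V] p.2) ⊗ X.obj p.2)).obj (Y.obj p.1) :=
  Pi.lift fun p ↦ Pi.π _ p.2 ≫ MonoidalClosed.curry
    ((α_ _ _ _).hom ≫ (p.1 ⟶[V] p.2) ◁ (ihom.ev (X.obj p.2)).app (Y.obj p.2) ≫ Y.act p.1 p.2)

/-- The object of `V` of `V`-natural transformations from `X` to `Y`, i.e. the end
`∫_a V(X a, Y a)`. -/
abbrev homObj (X Y : VPresheaf V C) : V := equalizer (homMapLeft X Y) (homMapRight X Y)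

/-- The projection of the end `∫_a V(X a, Y a)` to its factor at `a`. -/
def homProj (X Y : VPresheaf V C) (a : C) : homObj X Y ⟶ (ihom (X.obj a)).obj (Y.obj a) :=
  equalizer.ι (homMapLeft X Y) (homMapRight X Y) ≫ Pi.π _ a

theorem homProj_condition (X Y : VPresheaf V C) (a b : C) :
    homProj X Y a ≫ (MonoidalClosed.pre (X.act a b)).app (Y.obj a) =
      homProj X Y b ≫ MonoidalClosed.curry
        ((α_ _ _ _).hom ≫ (a ⟶[V] b) ◁ (ihom.ev (X.obj b)).app (Y.obj b) ≫ Y.act a b) := by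
  have h := equalizer.condition (homMapLeft X Y) (homMapRight X Y) =≫ Pi.π _ (a, b)
  have h1 : homMapLeft X Y ≫ Pi.π _ (a, b) = Pi.π _ a ≫
      (MonoidalClosed.pre (X.act a b)).app (Y.obj a) := limit.lift_π _ _
  have h2 : homMapRight X Y ≫ Pi.π _ (a, b) = Pi.π _ b ≫ MonoidalClosed.curry
      ((α_ _ _ _).hom ≫ (a ⟶[V] b) ◁ (ihom.ev (X.obj b)).app (Y.obj b) ≫ Y.act a b) :=
    limit.lift_π _ _
  rw [Category.assoc, Category.assoc, h1, h2] at h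
  rw [homProj, homProj, Category.assoc, Category.assoc]
  exact h

/-- Evaluation at `a`. -/
def homEv (X Y : VPresheaf V C) (a : C) : X.obj a ⊗ homObj X Y ⟶ Y.obj a :=
  MonoidalClosed.uncurry (homProj X Y a)

@[simp]
theorem homEv_naturality (X Y : VPresheaf V C) (a b : C) :
    X.act a b ▷ homObj X Y ≫ homEv X Y a =
      (α_ _ _ _).hom ≫ (a ⟶[V] b) ◁ homEv X Y b ≫ Y.act a b := by
  have h := congrArg MonoidalClosed.uncurry (homProj_condition X Y a b)
  rw [MonoidalClosed.uncurry_pre_app, MonoidalClosed.uncurry_natural_left,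
    MonoidalClosed.uncurry_curry] at h
  rw [homEv, h, homEv, MonoidalClosed.uncurry_eq]
  simp

theorem homObj_ext {X Y : VPresheaf V C} {A : V} {f g : A ⟶ homObj X Y}
    (h : ∀ a, X.obj a ◁ f ≫ homEv X Y a = X.obj a ◁ g ≫ homEv X Y a) : f = g := by
  apply equalizer.hom_ext
  apply Pi.hom_ext
  intro a
  rw [Category.assoc, Category.assoc]
  apply MonoidalClosed.uncurry_injective
  exact (MonoidalClosed.uncurry_natural_left f (homProj X Y a)).trans
    ((h a).trans (MonoidalClosed.uncurry_natural_left g (homProj X Y a)).symm)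

/-- The map `A ⟶ [Cᵒᵖ, V](X, Y)` corresponding to a `V`-natural family `X a ⊗ A ⟶ Y a`. -/
def homLift {X Y : VPresheaf V C} {A : V} (f : ∀ a, X.obj a ⊗ A ⟶ Y.obj a)
    (hf : ∀ a b, X.act a b ▷ A ≫ f a = (α_ _ _ _).hom ≫ (a ⟶[V] b) ◁ f b ≫ Y.act a b) :
    A ⟶ homObj X Y :=
  equalizer.lift (Pi.lift fun a ↦ MonoidalClosed.curry (f a)) (by
    apply Pi.hom_ext
    rintro ⟨a, b⟩
    simp only [homMapLeft, homMapRight, Category.assoc, limit.lift_π, Fan.mk_pt, Fan.mk_π_app,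
      limit.lift_π_assoc]
    apply MonoidalClosed.uncurry_injective
    rw [MonoidalClosed.uncurry_pre_app, MonoidalClosed.uncurry_curry,
      MonoidalClosed.uncurry_natural_left, MonoidalClosed.uncurry_curry, hf]
    simp [← MonoidalCategory.whiskerLeft_comp_assoc])

@[simp]
theorem homLift_homEv {X Y : VPresheaf V C} {A : V} (f : ∀ a, X.obj a ⊗ A ⟶ Y.obj a)
    (hf : ∀ a b, X.act a b ▷ A ≫ f a = (α_ _ _ _).hom ≫ (a ⟶[V] b) ◁ f b ≫ Y.act a b) (a : C) :
    X.obj a ◁ homLift f hf ≫ homEv X Y a = f a := by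
  have h : homLift f hf ≫ homProj X Y a = MonoidalClosed.curry (f a) := by
    rw [homLift, homProj, equalizer.lift_ι_assoc]
    exact limit.lift_π _ _
  rw [homEv, ← MonoidalClosed.uncurry_natural_left, h, MonoidalClosed.uncurry_curry]

/-- The composition `[Cᵒᵖ, V](X, Y) ⊗ [Cᵒᵖ, V](Y, Z) ⟶ [Cᵒᵖ, V](X, Z)`. -/
def homComp (X Y Z : VPresheaf V C) : homObj X Y ⊗ homObj Y Z ⟶ homObj X Z :=
  homLift (fun a ↦ (α_ _ _ _).inv ≫ homEv X Y a ▷ _ ≫ homEv Y Z a) (by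
    intro a b
    rw [associator_inv_naturality_left_assoc, ← comp_whiskerRight_assoc, homEv_naturality]
    simp)

@[simp]
theorem homComp_homEv (X Y Z : VPresheaf V C) (a : C) :
    X.obj a ◁ homComp X Y Z ≫ homEv X Z a = (α_ _ _ _).inv ≫ homEv X Y a ▷ _ ≫ homEv Y Z a :=
  homLift_homEv _ _ a

/-- The identity `𝟙_ V ⟶ [Cᵒᵖ, V](X, X)`. -/
def homId (X : VPresheaf V C) : 𝟙_ V ⟶ homObj X X :=
  homLift (fun a ↦ (ρ_ (X.obj a)).hom) (by simp)

@[simp]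
theorem homId_homEv (X : VPresheaf V C) (a : C) :
    X.obj a ◁ homId X ≫ homEv X X a = (ρ_ (X.obj a)).hom :=
  homLift_homEv _ _ a

/-- The `V`-category `[Cᵒᵖ, V]`. -/
instance : EnrichedCategory V (VPresheaf V C) where
  Hom X Y := homObj X Y
  id X := homId X
  comp X Y Z := homComp X Y Z
  id_comp X Y := by
    apply homObj_ext
    intro a
    simp only [MonoidalCategory.whiskerLeft_comp, Category.assoc, homComp_homEv]
    rw [associator_inv_naturality_middle_assoc, ← comp_whiskerRight_assoc, homId_homEv]
    simp
  comp_id X Y := by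
    apply homObj_ext
    intro a
    simp only [MonoidalCategory.whiskerLeft_comp, Category.assoc, homComp_homEv]
    rw [associator_inv_naturality_right_assoc, whisker_exchange_assoc, homId_homEv]
    simp
  assoc W X Y Z := by
    apply homObj_ext
    intro a
    simp only [MonoidalCategory.whiskerLeft_comp, Category.assoc, homComp_homEv]
    rw [associator_inv_naturality_middle_assoc, ← comp_whiskerRight_assoc, homComp_homEv,
      associator_inv_naturality_right_assoc, whisker_exchange_assoc, homComp_homEv]
    simp

/-- The action `C(c, c') ⟶ [Cᵒᵖ, V](C(-, c), C(-, c'))` of the Yoneda embedding. -/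
def yonedaMap (c c' : C) : (c ⟶[V] c') ⟶ homObj (representable (V := V) c) (representable c') :=
  homLift (X := representable c) (Y := representable c') (fun a ↦ eComp V a c c')
    (fun a b ↦ (e_assoc' V a b c c').symm)

@[simp]
theorem yonedaMap_homEv (a c c' : C) :
    (a ⟶[V] c) ◁ yonedaMap c c' ≫ homEv (representable c) (representable c') a =
      eComp V a c c' :=
  homLift_homEv (X := representable c) (Y := representable c') _ _ a

theorem yonedaMap_comp (c c' c'' : C) :
    eComp V c c' c'' ≫ yonedaMap c c'' =
      (yonedaMap c c' ⊗ₘ yonedaMap c' c'') ≫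
        homComp (representable c) (representable c') (representable c'') := by
  apply homObj_ext
  intro a
  rw [MonoidalCategory.whiskerLeft_comp, Category.assoc, yonedaMap_homEv,
    MonoidalCategory.whiskerLeft_comp, Category.assoc, homComp_homEv,
    MonoidalCategory.tensorHom_def, MonoidalCategory.whiskerLeft_comp, Category.assoc,
    associator_inv_naturality_right_assoc, whisker_exchange_assoc, yonedaMap_homEv,
    associator_inv_naturality_middle_assoc, ← comp_whiskerRight_assoc, yonedaMap_homEv, e_assoc]

/-- The Yoneda embedding `y_C : C → [Cᵒᵖ, V]`, a `V`-functor. -/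
def yoneda : EnrichedFunctor V C (VPresheaf V C) where
  obj c := representable c
  map c c' := yonedaMap c c'
  map_id c := by
    apply homObj_ext
    intro a
    rw [MonoidalCategory.whiskerLeft_comp, Category.assoc, yonedaMap_homEv]
    refine Eq.trans ?_ (homId_homEv _ a).symm
    rw [← cancel_epi (ρ_ _).inv, e_comp_id, Iso.inv_hom_id]
  map_comp c c' c'' := yonedaMap_comp c c' c''

end HomObject

/-! #### Weighted colimits -/

section WeightedColimit

variable {V : Type u} [Category.{v} V] [MonoidalCategory V] [MonoidalClosed V]
  [HasLimitsOfSize.{v, v} V]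
variable {D : Type v} [EnrichedCategory V D] {M : Type w} [EnrichedCategory V M]

/-- For a weight `W`, a diagram `G : D → M` and a `V`-natural transformation `ξ : W ⟶ M(G -, X)`,
the map `M(X, Y) ⟶ [Dᵒᵖ, V](W, M(G -, Y))` given by composing with `ξ`. -/
def weightedComparison (W : VPresheaf V D) (G : EnrichedFunctor V D M) {X : M}
    (ξ : W ⟶ restrict G (representable X)) (Y : M) :
    (X ⟶[V] Y) ⟶ homObj W (restrict G (representable Y)) :=
  homLift (fun d ↦ ξ.app d ▷ (X ⟶[V] Y) ≫ eComp V (G.obj d) X Y) (by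
    intro a b
    rw [← comp_whiskerRight_assoc, ξ.naturality]
    simp only [comp_whiskerRight, Category.assoc, MonoidalCategory.whiskerLeft_comp]
    rw [← e_assoc']
    simp [whisker_exchange_assoc])

/-- `X`, together with `ξ : W ⟶ M(G -, X)`, is a colimit `W ⋆_D G` of `G : D → M` weighted by
`W`: composition with `ξ` gives an isomorphism `M(X, Y) ≅ [Dᵒᵖ, V](W, M(G -, Y))` for all `Y`.
By the Yoneda lemma, every isomorphism of this form `V`-natural in `Y` arises in this way. -/
def IsWeightedColimit (W : VPresheaf V D) (G : EnrichedFunctor V D M) (X : M)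
    (ξ : W ⟶ restrict G (representable X)) : Prop :=
  ∀ Y : M, IsIso (weightedComparison W G ξ Y)

end WeightedColimit

/-! #### The left adjoint of restriction -/

section Extension

variable {V : Type u} [Category.{v} V] [MonoidalCategory V] [HasColimitsOfSize.{v, v} V]
variable {D : Type v} [EnrichedCategory V D] {C : Type w} [EnrichedCategory V C]
section Coend

variable (F : EnrichedFunctor V D C) (W : VPresheaf V D)

/-- The two maps whose coequalizer is the coend `∫^d C(c, F d) ⊗ W d`: one is given by the action
of `D` on `C(c, F -)`, the other one by the action of `D` on `W`. -/
def extMapLeft (c : C) :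
    (∐ fun p : D × D ↦ ((c ⟶[V] F.obj p.1) ⊗ (p.1 ⟶[V] p.2)) ⊗ W.obj p.2) ⟶
      ∐ fun d : D ↦ (c ⟶[V] F.obj d) ⊗ W.obj d :=
  Sigma.desc fun p ↦ ((c ⟶[V] F.obj p.1) ◁ F.map p.1 p.2 ≫ eComp V _ _ _) ▷ W.obj p.2 ≫
    Sigma.ι (fun d : D ↦ (c ⟶[V] F.obj d) ⊗ W.obj d) p.2

/-- The second of the two maps described for `extMapLeft`. -/
def extMapRight (c : C) :
    (∐ fun p : D × D ↦ ((c ⟶[V] F.obj p.1) ⊗ (p.1 ⟶[V] p.2)) ⊗ W.obj p.2) ⟶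
      ∐ fun d : D ↦ (c ⟶[V] F.obj d) ⊗ W.obj d :=
  Sigma.desc fun p ↦ (α_ _ _ _).hom ≫ (c ⟶[V] F.obj p.1) ◁ W.act p.1 p.2 ≫
    Sigma.ι (fun d : D ↦ (c ⟶[V] F.obj d) ⊗ W.obj d) p.1

/-- The coend `∫^d C(c, F d) ⊗ W d`. -/
abbrev extObj (c : C) : V := coequalizer (extMapLeft F W c) (extMapRight F W c)

/-- The coprojection to the coend. -/
def extι (c : C) (d : D) : (c ⟶[V] F.obj d) ⊗ W.obj d ⟶ extObj F W c :=
  Sigma.ι (fun d : D ↦ (c ⟶[V] F.obj d) ⊗ W.obj d) d ≫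
    coequalizer.π (extMapLeft F W c) (extMapRight F W c)

theorem extι_condition (c : C) (d e : D) :
    (c ⟶[V] F.obj d) ◁ F.map d e ▷ W.obj e ≫ (α_ _ _ _).inv ≫ eComp V _ _ _ ▷ W.obj e ≫
      extι F W c e = (c ⟶[V] F.obj d) ◁ W.act d e ≫ extι F W c d := by
  have h := Sigma.ι (fun p : D × D ↦ ((c ⟶[V] F.obj p.1) ⊗ (p.1 ⟶[V] p.2)) ⊗ W.obj p.2) (d, e) ≫=
    coequalizer.condition (extMapLeft F W c) (extMapRight F W c)
  have h1 := colimit.ι_desc_assoc (Cofan.mk _ fun p : D × D ↦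
    ((c ⟶[V] F.obj p.1) ◁ F.map p.1 p.2 ≫ eComp V _ _ _) ▷ W.obj p.2 ≫
      Sigma.ι (fun d : D ↦ (c ⟶[V] F.obj d) ⊗ W.obj d) p.2) ⟨(d, e)⟩
      (coequalizer.π (extMapLeft F W c) (extMapRight F W c))
  have h2 := colimit.ι_desc_assoc (Cofan.mk _ fun p : D × D ↦
    (α_ _ _ _).hom ≫ (c ⟶[V] F.obj p.1) ◁ W.act p.1 p.2 ≫
      Sigma.ι (fun d : D ↦ (c ⟶[V] F.obj d) ⊗ W.obj d) p.1) ⟨(d, e)⟩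
      (coequalizer.π (extMapLeft F W c) (extMapRight F W c))
  have h3 := h1.symm.trans (h.trans h2)
  rw [← cancel_epi (α_ _ _ _).hom]
  simpa [extι] using h3

/-- The universal property of the coend. -/
def extDesc {c : C} {Z : V} (f : ∀ d, (c ⟶[V] F.obj d) ⊗ W.obj d ⟶ Z)
    (hf : ∀ d e, (c ⟶[V] F.obj d) ◁ F.map d e ▷ W.obj e ≫ (α_ _ _ _).inv ≫
      eComp V _ _ _ ▷ W.obj e ≫ f e = (c ⟶[V] F.obj d) ◁ W.act d e ≫ f d) :
    extObj F W c ⟶ Z :=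
  coequalizer.desc (Sigma.desc f) (by
    apply Sigma.hom_ext
    rintro ⟨d, e⟩
    have := (α_ _ _ _).hom ≫= hf d e
    simpa [extMapLeft, extMapRight] using this)

@[simp]
theorem extι_extDesc {c : C} {Z : V} (f : ∀ d, (c ⟶[V] F.obj d) ⊗ W.obj d ⟶ Z)
    (hf : ∀ d e, (c ⟶[V] F.obj d) ◁ F.map d e ▷ W.obj e ≫ (α_ _ _ _).inv ≫
      eComp V _ _ _ ▷ W.obj e ≫ f e = (c ⟶[V] F.obj d) ◁ W.act d e ≫ f d) (d : D) :
    extι F W c d ≫ extDesc F W f hf = f d := by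
  simp [extι, extDesc]

variable {F W} in
theorem extObj_ext {c : C} {Z : V} {f g : extObj F W c ⟶ Z}
    (h : ∀ d, extι F W c d ≫ f = extι F W c d ≫ g) : f = g := by
  apply coequalizer.hom_ext
  apply Sigma.hom_ext
  intro d
  simpa [extι] using h d

end Coend

variable [MonoidalClosed V] (F : EnrichedFunctor V D C) (W : VPresheaf V D)

variable {F W} in
theorem tensor_extObj_ext {c : C} {A Z : V} {f g : A ⊗ extObj F W c ⟶ Z}
    (h : ∀ d, A ◁ extι F W c d ≫ f = A ◁ extι F W c d ≫ g) : f = g := by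
  apply MonoidalClosed.curry_injective
  apply extObj_ext
  intro d
  rw [← MonoidalClosed.curry_natural_left, ← MonoidalClosed.curry_natural_left, h d]

/-- The action of `C` on the coends `∫^d C(c, F d) ⊗ W d`. -/
def extAct (a b : C) : (a ⟶[V] b) ⊗ extObj F W b ⟶ extObj F W a :=
  MonoidalClosed.uncurry (extDesc F W (fun d ↦ MonoidalClosed.curry
    ((α_ _ _ _).inv ≫ eComp V a b (F.obj d) ▷ W.obj d ≫ extι F W a d)) (by
    intro d e
    rw [← MonoidalClosed.curry_natural_left, ← MonoidalClosed.curry_natural_left,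
      ← MonoidalClosed.curry_natural_left, ← MonoidalClosed.curry_natural_left]
    congr 1
    have h : (a ⟶[V] b) ◁ (b ⟶[V] F.obj d) ◁ W.act d e ≫ (α_ _ _ _).inv ≫
        eComp V a b (F.obj d) ▷ W.obj d ≫ extι F W a d =
        (α_ _ _ _).inv ≫ eComp V a b (F.obj d) ▷ ((d ⟶[V] e) ⊗ W.obj e) ≫
          (a ⟶[V] F.obj d) ◁ W.act d e ≫ extι F W a d := by
      rw [associator_inv_naturality_right_assoc, whisker_exchange_assoc]
    rw [h, ← extι_condition]
    have h' : eComp V a b (F.obj d) ▷ ((d ⟶[V] e) ⊗ W.obj e) ≫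
        (a ⟶[V] F.obj d) ◁ F.map d e ▷ W.obj e =
        (_ ◁ F.map d e ▷ W.obj e) ≫
          eComp V a b (F.obj d) ▷ ((F.obj d ⟶[V] F.obj e) ⊗ W.obj e) :=
      (whisker_exchange _ _).symm
    rw [reassoc_of% h']
    have h'' := e_assoc V a b (F.obj d) (F.obj e)
    have h3 : (a ⟶[V] b) ◁ eComp V b (F.obj d) (F.obj e) ▷ W.obj e ≫ (α_ _ _ _).inv ≫
        eComp V a b (F.obj e) ▷ W.obj e = (α_ _ _ _).inv ≫
          ((a ⟶[V] b) ◁ eComp V b (F.obj d) (F.obj e) ≫ eComp V a b (F.obj e)) ▷ W.obj e := by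
      simp
    rw [reassoc_of% h3, ← h'']
    simp [-e_assoc, -e_assoc_assoc]))

@[simp]
theorem extι_extAct (a b : C) (d : D) :
    (a ⟶[V] b) ◁ extι F W b d ≫ extAct F W a b =
      (α_ _ _ _).inv ≫ eComp V a b (F.obj d) ▷ W.obj d ≫ extι F W a d := by
  rw [extAct, ← MonoidalClosed.uncurry_natural_left, extι_extDesc, MonoidalClosed.uncurry_curry]

theorem extι_extAct_assoc (a b : C) (d : D) {Z : V} (h : extObj F W a ⟶ Z) :
    (a ⟶[V] b) ◁ extι F W b d ≫ extAct F W a b ≫ h =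
      (α_ _ _ _).inv ≫ eComp V a b (F.obj d) ▷ W.obj d ≫ extι F W a d ≫ h := by
  rw [← Category.assoc, extι_extAct, Category.assoc, Category.assoc]

/-- The presheaf `F_! W = W ⋆_D y_C F`, with value `∫^d C(c, F d) ⊗ W d` at `c`. -/
abbrev extend : VPresheaf V C where
  obj c := extObj F W c
  act a b := extAct F W a b
  act_id a := by
    apply tensor_extObj_ext
    intro d
    rw [whisker_exchange_assoc, extι_extAct, leftUnitor_naturality]
    have h : eId V a ▷ (a ⟶[V] F.obj d) ≫ eComp V a a (F.obj d) = (λ_ _).hom :=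
      (representable (V := V) (F.obj d)).act_id a
    rw [associator_inv_naturality_left_assoc, ← comp_whiskerRight_assoc, h]
    simp
  act_comp a b c := by
    apply tensor_extObj_ext
    intro d
    rw [whisker_exchange_assoc, extι_extAct, associator_naturality_right_assoc,
      ← MonoidalCategory.whiskerLeft_comp_assoc, extι_extAct]
    simp only [MonoidalCategory.whiskerLeft_comp, Category.assoc, extι_extAct]
    rw [associator_inv_naturality_left_assoc, ← comp_whiskerRight_assoc, ← e_assoc']
    simp

/-- The unit `W ⟶ F^* F_! W`. -/
def extUnit : W ⟶ restrict F (extend F W) where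
  app d := (λ_ (W.obj d)).inv ≫ eId V (F.obj d) ▷ W.obj d ≫ extι F W (F.obj d) d
  naturality d e := by
    have h1 : eId V (F.obj d) ▷ (F.obj d ⟶[V] F.obj e) ≫ eComp V _ _ (F.obj e) = (λ_ _).hom :=
      (representable (V := V) (F.obj e)).act_id (F.obj d)
    have h2 : (F.obj d ⟶[V] F.obj e) ◁ eId V (F.obj e) ≫ eComp V _ _ _ = (ρ_ _).hom := by
      rw [← cancel_epi (ρ_ _).inv, e_comp_id, Iso.inv_hom_id]
    have l : W.act d e ≫ (λ_ (W.obj d)).inv ≫ eId V (F.obj d) ▷ W.obj d ≫ extι F W (F.obj d) d =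
        F.map d e ▷ W.obj e ≫ extι F W (F.obj d) e := by
      rw [leftUnitor_inv_naturality_assoc, whisker_exchange_assoc, ← extι_condition,
        ← whisker_exchange_assoc, associator_inv_naturality_left_assoc,
        ← comp_whiskerRight_assoc, h1]
      simp
    have r : (d ⟶[V] e) ◁ ((λ_ (W.obj e)).inv ≫ eId V (F.obj e) ▷ W.obj e ≫
        extι F W (F.obj e) e) ≫ F.map d e ▷ extObj F W (F.obj e) ≫
          extAct F W (F.obj d) (F.obj e) = F.map d e ▷ W.obj e ≫ extι F W (F.obj d) e := by
      rw [whisker_exchange_assoc]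
      simp only [MonoidalCategory.whiskerLeft_comp, Category.assoc, extι_extAct]
      rw [associator_inv_naturality_middle_assoc, ← comp_whiskerRight_assoc, h2]
      simp
    exact l.trans r.symm

@[simp]
theorem extUnit_app (d : D) : (extUnit F W).app d =
    (λ_ (W.obj d)).inv ≫ eId V (F.obj d) ▷ W.obj d ≫ extι F W (F.obj d) d := rfl

variable {F W}

/-- The map `F_! W ⟶ X` corresponding to `g : W ⟶ F^* X`. -/
def extHomDesc {X : VPresheaf V C} (g : W ⟶ restrict F X) : extend F W ⟶ X where
  app c := extDesc F W (fun d ↦ (c ⟶[V] F.obj d) ◁ g.app d ≫ X.act c (F.obj d))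
    (act_act_of_hom g c)
  naturality a b := by
    apply tensor_extObj_ext
    intro d
    rw [extι_extAct_assoc, extι_extDesc, ← MonoidalCategory.whiskerLeft_comp_assoc, extι_extDesc,
      ← whisker_exchange_assoc, act_comp]
    simp

@[simp]
theorem extι_extHomDesc {X : VPresheaf V C} (g : W ⟶ restrict F X) (c : C) (d : D) :
    extι F W c d ≫ (extHomDesc g).app c = (c ⟶[V] F.obj d) ◁ g.app d ≫ X.act c (F.obj d) :=
  extι_extDesc F W _ (act_act_of_hom g c) d

variable (F W)

/-- The bijection defining the adjunction `F_! ⊣ F^*`. -/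
def extEquiv (X : VPresheaf V C) : (extend F W ⟶ X) ≃ (W ⟶ restrict F X) where
  toFun f := extUnit F W ≫ restrictMap F f
  invFun g := extHomDesc g
  left_inv f := by
    refine hom_ext fun c ↦ extObj_ext fun d ↦ ?_
    dsimp only
    have h := f.naturality c (F.obj d)
    have h2 : (c ⟶[V] F.obj d) ◁ eId V (F.obj d) ≫ eComp V _ _ _ = (ρ_ _).hom := by
      rw [← cancel_epi (ρ_ _).inv, e_comp_id, Iso.inv_hom_id]
    have h3 : (extUnit F W ≫ restrictMap F f).app d =
      ((λ_ (W.obj d)).inv ≫ eId V (F.obj d) ▷ W.obj d ≫ extι F W (F.obj d) d) ≫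
        f.app (F.obj d) := rfl
    rw [extι_extHomDesc, h3, MonoidalCategory.whiskerLeft_comp, Category.assoc, ← h]
    simp only [MonoidalCategory.whiskerLeft_comp, Category.assoc, extι_extAct_assoc]
    rw [associator_inv_naturality_middle_assoc, ← comp_whiskerRight_assoc, h2]
    simp
  right_inv g := by
    refine hom_ext fun d ↦ ?_
    dsimp only
    have h3 : (extUnit F W ≫ restrictMap F (extHomDesc g)).app d =
      ((λ_ (W.obj d)).inv ≫ eId V (F.obj d) ▷ W.obj d ≫ extι F W (F.obj d) d) ≫
        (extHomDesc g).app (F.obj d) := rfl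
    rw [h3, Category.assoc, Category.assoc, extι_extHomDesc, ← whisker_exchange_assoc, act_id]
    simp

/-- The functor `F_! : [Dᵒᵖ, V] → [Cᵒᵖ, V]`. -/
def extension : VPresheaf V D ⥤ VPresheaf V C :=
  Adjunction.leftAdjointOfEquiv (G := restriction F) (F_obj := extend F) (extEquiv F) (by
    intro W X Y g h
    exact hom_ext fun d ↦ (Category.assoc _ _ _).symm)

/-- The adjunction `F_! ⊣ F^*`. -/
def extensionAdjunction : extension F ⊣ restriction F :=
  Adjunction.adjunctionOfEquivLeft (G := restriction F) (F_obj := extend F) (extEquiv F) (by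
    intro W X Y g h
    exact hom_ext fun d ↦ (Category.assoc _ _ _).symm)

end Extension

/-! #### The projective model structure -/

section Projective

variable {V : Type u} [Category.{v} V] [MonoidalCategory V]
variable {C : Type w} [EnrichedCategory V C]

instance [MonoidalClosed V] [HasInitial V] : HasInitial (VPresheaf V C) := by
  have h {A Z : V} (f g : A ⊗ ⊥_ V ⟶ Z) : f = g :=
    MonoidalClosed.curry_injective (Subsingleton.elim _ _)
  let X : VPresheaf V C :=
    { obj _ := ⊥_ V
      act _ _ := MonoidalClosed.uncurry (initial.to _)
      act_id _ := h _ _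
      act_comp _ _ _ := h _ _ }
  have (Y : VPresheaf V C) : Unique (X ⟶ Y) :=
    { default := { app _ := initial.to _, naturality _ _ := h _ _ }
      uniq _ := hom_ext fun _ ↦ Subsingleton.elim _ _ }
  exact hasInitial_of_unique X

instance [HasTerminal V] : HasTerminal (VPresheaf V C) := by
  let X : VPresheaf V C :=
    { obj _ := ⊤_ V
      act _ _ := terminal.from _
      act_id _ := Subsingleton.elim _ _
      act_comp _ _ _ := Subsingleton.elim _ _ }
  have (Y : VPresheaf V C) : Unique (Y ⟶ X) :=
    { default := { app _ := terminal.from _, naturality _ _ := Subsingleton.elim _ _ }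
      uniq _ := hom_ext fun _ ↦ Subsingleton.elim _ _ }
  exact hasTerminal_of_unique X

variable [ModelCategory V]

/-- Weak equivalences are pointwise. -/
instance : CategoryWithWeakEquivalences (VPresheaf V C) where
  weakEquivalences _ _ f := ∀ c, WeakEquivalence (f.app c)

/-- Fibrations are pointwise. -/
instance : CategoryWithFibrations (VPresheaf V C) where
  fibrations _ _ f := ∀ c, Fibration (f.app c)

/-- Cofibrations have the left lifting property with respect to the trivial fibrations. -/
instance : CategoryWithCofibrations (VPresheaf V C) where
  cofibrations := (trivialFibrations (VPresheaf V C)).llp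

end Projective

end VPresheaf

/-! ### The conditions of the theorem -/

section Conditions

variable {V : Type u} [Category.{v} V] [MonoidalCategory V] [ModelCategory V]
variable {D C : Type v} [EnrichedCategory V D] [EnrichedCategory V C]

/-- `F` is homotopically full and faithful if all maps `D(d', d) ⟶ C(F d', F d)` are weak
equivalences. -/
def IsHomotopicallyFullyFaithful (F : EnrichedFunctor V D C) : Prop :=
  ∀ d' d : D, WeakEquivalence (F.map d' d)

/-- `c` is a homotopy absolute homotopy weighted colimit of `F`: for some cofibrant weight
`W : Dᵒᵖ → V`, the weighted colimit `W ⋆_D y_C F` in `[Cᵒᵖ, V]` is weakly equivalent to the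
representable presheaf `C(-, c)`. -/
def IsHomotopyAbsoluteColimit [MonoidalClosed V] [HasLimitsOfSize.{v, v} V]
    (F : EnrichedFunctor V D C) (c : C) : Prop :=
  ∃ (W : VPresheaf V D) (X : VPresheaf V C)
    (ξ : W ⟶ VPresheaf.restrict (F.comp V VPresheaf.yoneda) (VPresheaf.representable X)),
    IsCofibrant W ∧ VPresheaf.IsWeightedColimit W (F.comp V VPresheaf.yoneda) X ξ ∧
      WeaklyEquivalent X (VPresheaf.representable c)

end Conditions

end

noncomputable section

/-! Here F_! W is the coend ∫^d C(-, F d) ⊗ W d. Local flatness makes every evaluation functor left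
Quillen, since its right adjoint Z ↦ [C(c, -), Z] preserves fibrations and trivial fibrations. With
this, the small object argument yields the projective model structure, and F_! ⊣ F^* is a Quillen
adjunction for every F. By the enriched Yoneda lemma, the colimits of y_C F weighted by W are
exactly the presheaves isomorphic to F_! W (`isWeightedColimit_iff`).

Suppose the adjunction is a Quillen equivalence. For condition 2, let R be a fibrant replacement of
C(-, c) and W a cofibrant replacement of F^* R; the transpose F_! W → R is a weak equivalence. For
condition 1, let Q be a cofibrant replacement of the unit. Then D(-, d) ⊗ Q is cofibrant and F_!
sends it to C(-, F d) ⊗ Q, so its derived unit, evaluated at d', is F on D(d', d) up to weak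
equivalences.

For the converse two facts suffice: W → F^* F_! W is a weak equivalence for cofibrant W, and F^*
reflects weak equivalences between fibrant presheaves.

The first fact (`weakEquivalence_extUnit`) needs no cell induction. The component of the unit at d
is a transformation from evaluation at d to F_! followed by evaluation at F d, both left Quillen.
Its mate is the map [C(F d, F -), Z] → [D(d, -), Z] given by precomposition with F. By
`IsLeftQuillen.weakEquivalence_iff_of_mates` it is enough to treat the mate for fibrant Z, and there
F is a weak equivalence between flat objects.

For the second fact, let F^* p be a weak equivalence, and call T local if p induces a bijection on
maps out of T in the homotopy category. The adjunction makes F_! W local for cofibrant W, hence also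
F_! W ⊗ A ≅ F_!(W ⊗ A). Condition 2 transports this to C(-, c) ⊗ A. Maps out of that presheaf are
maps out of A into the value at c, so p is a weak equivalence at each c.

Hom-objects are only flat and the unit need not be cofibrant. The bridge is
`IsFlatObject.weakEquivalence_whiskerLeft`, an application of the two-out-of-six property, which in
turn rests on the saturation of weak equivalences. -/

theorem bijective_precomp_of_isIso {M : Type*} [Category* M] {X Y : M} (f : X ⟶ Y) [IsIso f]
    (Z : M) : Function.Bijective fun g : Y ⟶ Z ↦ f ≫ g :=
  ⟨fun _ _ h ↦ (cancel_epi f).1 h, fun g ↦ ⟨inv f ≫ g, by simp⟩⟩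

theorem bijective_postcomp_of_isIso {M : Type*} [Category* M] {X Y : M} (f : X ⟶ Y) [IsIso f]
    (Z : M) : Function.Bijective fun g : Z ⟶ X ↦ g ≫ f :=
  ⟨fun _ _ h ↦ (cancel_mono f).1 h, fun g ↦ ⟨g ≫ inv f, by simp⟩⟩

/-! ### Saturation of the weak equivalences of a model category -/

section Saturation

variable {M : Type*} [Category* M] [ModelCategory M] {H : Type*} [Category* H]
  (L : M ⥤ H) [L.IsLocalization (weakEquivalences M)]

theorem isIso_map_of_weakEquivalence {X Y : M} (f : X ⟶ Y) [WeakEquivalence f] :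
    IsIso (L.map f) :=
  Localization.inverts L (weakEquivalences M) f (mem_weakEquivalences f)

/-- A fibration between bifibrant objects which is inverted by the localization is a weak
equivalence. -/
theorem weakEquivalence_of_isIso_map_of_fibration {X Y : M} (p : X ⟶ Y) [IsCofibrant X]
    [IsFibrant X] [IsCofibrant Y] [IsFibrant Y] [Fibration p] [IsIso (L.map p)] :
    WeakEquivalence p := by
  -- The inverse of `L.map p` is represented by an actual map `r`, because `Y` is cofibrant and `X`
  -- is fibrant.
  obtain ⟨r, hr⟩ := map_surjective_of_isLocalization L Y X (inv (L.map p))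
  have h : LeftHomotopyRel (r ≫ p) (𝟙 Y) := by
    rw [LeftHomotopyRel.iff_map_eq L]; simp [hr]
  obtain ⟨P, _, ⟨h⟩⟩ := h.exists_good_cylinder
  -- As `p` is a fibration, the homotopy from `r ≫ p` to the identity lifts, which deforms `r` to a
  -- strict section `s` of `p`.
  obtain ⟨s, h', hs⟩ := h.covering_homotopy p r rfl
  have hsp : s ≫ p = 𝟙 Y := by rw [← h'.h₁, Category.assoc, hs, h.h₁]
  have hs' : LeftHomotopyRel (p ≫ s) (𝟙 X) := by
    rw [LeftHomotopyRel.iff_map_eq L, L.map_comp, L.map_id,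
      ← (LeftHomotopyRel.iff_map_eq L _ _).1 h'.leftHomotopyRel, hr, IsIso.hom_inv_id]
  obtain ⟨P', ⟨h''⟩⟩ := hs'
  have : WeakEquivalence (p ≫ s) := h''.weakEquivalence_iff.2 inferInstance
  rw [weakEquivalence_iff] at this ⊢
  -- Since `s ≫ p = 𝟙`, the map `p` is a retract of `p ≫ s`, and the latter is homotopic to an
  -- identity.
  refine MorphismProperty.of_retract (P := weakEquivalences M) (f := p) (g := p ≫ s) ?_ this
  exact { i := Arrow.homMk (𝟙 _) s, r := Arrow.homMk (𝟙 _) p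
          retract := by ext <;> simp [hsp] }

/-- Cofibrant and then fibrant replacement reduce to bifibrant objects. There, factoring off a
trivial cofibration leaves a fibration, to which the previous theorem applies. -/
theorem weakEquivalence_of_isIso_map {X Y : M} (f : X ⟶ Y) [IsIso (L.map f)] :
    WeakEquivalence f := by
  wlog _ : IsCofibrant X ∧ IsCofibrant Y generalizing X Y
  · obtain ⟨X', _, p, _, _⟩ := CofibrantObject.HoCat.exists_resolution X
    obtain ⟨Y', _, q, _, _⟩ := CofibrantObject.HoCat.exists_resolution Y
    have sq : CommSq (initial.to Y') (initial.to X') q (p ≫ f) := ⟨Subsingleton.elim _ _⟩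
    have fac : sq.lift ≫ q = p ≫ f := sq.fac_right
    have hp := isIso_map_of_weakEquivalence L p
    have hq := isIso_map_of_weakEquivalence L q
    have hl : IsIso (L.map sq.lift) := by
      have : IsIso (L.map sq.lift ≫ L.map q) := by
        rw [← L.map_comp, fac, L.map_comp]; infer_instance
      exact IsIso.of_isIso_comp_right _ (L.map q)
    have := this sq.lift ⟨inferInstance, inferInstance⟩
    exact weakEquivalence_of_precomp_of_fac fac.symm
  obtain ⟨_, _⟩ := ‹IsCofibrant X ∧ IsCofibrant Y›
  wlog _ : IsFibrant X ∧ IsFibrant Y generalizing X Y with IH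
  · obtain ⟨X', _, i, _, _⟩ := FibrantObject.HoCat.exists_resolution X
    obtain ⟨Y', _, j, _, _⟩ := FibrantObject.HoCat.exists_resolution Y
    have sq : CommSq (f ≫ j) i (terminal.from Y') (terminal.from X') :=
      ⟨Subsingleton.elim _ _⟩
    have fac : i ≫ sq.lift = f ≫ j := sq.fac_left
    have _ := isCofibrant_of_cofibration i
    have _ := isCofibrant_of_cofibration j
    have hi := isIso_map_of_weakEquivalence L i
    have hj := isIso_map_of_weakEquivalence L j
    have hl : IsIso (L.map sq.lift) := by
      have : IsIso (L.map i ≫ L.map sq.lift) := by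
        rw [← L.map_comp, fac, L.map_comp]; infer_instance
      exact IsIso.of_isIso_comp_left (L.map i) _
    have := IH sq.lift ⟨inferInstance, inferInstance⟩ inferInstance inferInstance
      ⟨inferInstance, inferInstance⟩
    exact weakEquivalence_of_postcomp_of_fac fac.symm
  obtain ⟨_, _⟩ := ‹IsFibrant X ∧ IsFibrant Y›
  have h := MorphismProperty.factorizationData (trivialCofibrations M) (fibrations M) f
  have := isCofibrant_of_cofibration h.i
  have := isFibrant_of_fibration h.p
  have := isIso_map_of_weakEquivalence L h.i
  have : IsIso (L.map h.p) := by
    have : IsIso (L.map h.i ≫ L.map h.p) := by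
      rw [← L.map_comp, h.fac]; infer_instance
    exact IsIso.of_isIso_comp_left (L.map h.i) _
  have := weakEquivalence_of_isIso_map_of_fibration L h.p
  rw [← h.fac]
  infer_instance

/-- The two-out-of-six property. -/
theorem weakEquivalence_of_two_out_of_six {A B X Y : M} (f : A ⟶ B) (g : B ⟶ X) (h : X ⟶ Y)
    [WeakEquivalence (f ≫ g)] [WeakEquivalence (g ≫ h)] : WeakEquivalence g := by
  let L := (weakEquivalences M).Q
  have h₁ := isIso_map_of_weakEquivalence L (f ≫ g)
  have h₂ := isIso_map_of_weakEquivalence L (g ≫ h)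
  rw [L.map_comp] at h₁ h₂
  -- After localization, invertibility of f ≫ g splits g and invertibility of g ≫ h makes g mono.
  have : IsSplitEpi (L.map g) := .mk' ⟨inv (L.map f ≫ L.map g) ≫ L.map f, by simp⟩
  have : Mono (L.map g) := mono_of_mono _ (L.map h)
  have : IsIso (L.map g) := isIso_of_mono_of_isSplitEpi _
  exact weakEquivalence_of_isIso_map L g

/-- A map is a weak equivalence if it induces bijections in the homotopy category on maps from
all cofibrant objects. -/
theorem weakEquivalence_of_bijective_postcomp {X Y : M} (f : X ⟶ Y)
    (hf : ∀ (A : M) [IsCofibrant A],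
      Function.Bijective fun g : L.obj A ⟶ L.obj X ↦ g ≫ L.map f) : WeakEquivalence f := by
  obtain ⟨X', _, p, _, _⟩ := CofibrantObject.HoCat.exists_resolution X
  obtain ⟨Y', _, q, _, _⟩ := CofibrantObject.HoCat.exists_resolution Y
  have := isIso_map_of_weakEquivalence L p
  have := isIso_map_of_weakEquivalence L q
  obtain ⟨s, hs⟩ := (hf Y').2 (L.map q)
  have : IsSplitEpi (L.map f) := .mk' ⟨inv (L.map q) ≫ s, by simp [hs]⟩
  obtain ⟨t, ht⟩ : ∃ t, t = section_ (L.map f) := ⟨_, rfl⟩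
  have ht' : t ≫ L.map f = 𝟙 _ := by rw [ht]; exact IsSplitEpi.id _
  have : L.map f ≫ t = 𝟙 _ := by
    rw [← cancel_epi (L.map p)]
    apply (hf X').1
    simp [ht']
  have : IsIso (L.map f) := ⟨t, this, ht'⟩
  exact weakEquivalence_of_isIso_map L f

/-- A map is a weak equivalence if it induces bijections in the homotopy category on maps to
all fibrant objects. -/
theorem weakEquivalence_of_bijective_precomp {X Y : M} (f : X ⟶ Y)
    (hf : ∀ (Z : M) [IsFibrant Z],
      Function.Bijective fun g : L.obj Y ⟶ L.obj Z ↦ L.map f ≫ g) : WeakEquivalence f := by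
  obtain ⟨X', _, i, _, _⟩ := FibrantObject.HoCat.exists_resolution X
  obtain ⟨Y', _, j, _, _⟩ := FibrantObject.HoCat.exists_resolution Y
  have := isIso_map_of_weakEquivalence L i
  have := isIso_map_of_weakEquivalence L j
  obtain ⟨s, hs⟩ := (hf X').2 (L.map i)
  obtain ⟨t, ht⟩ : ∃ t, t = s ≫ inv (L.map i) := ⟨_, rfl⟩
  have ht' : L.map f ≫ t = 𝟙 _ := by rw [ht, reassoc_of% hs, IsIso.hom_inv_id]
  have : t ≫ L.map f = 𝟙 _ := by
    rw [← cancel_mono (L.map j)]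
    apply (hf Y').1
    simp [reassoc_of% ht']
  have : IsIso (L.map f) := ⟨t, ht', this⟩
  exact weakEquivalence_of_isIso_map L f

end Saturation

/-! ### Left Quillen functors -/

/-- A functor preserving cofibrations and trivial cofibrations. -/
structure IsLeftQuillen {M N : Type*} [Category* M] [Category* N] [ModelCategory M]
    [ModelCategory N] (G : M ⥤ N) : Prop where
  cofibration {X Y : M} (f : X ⟶ Y) [Cofibration f] : Cofibration (G.map f)
  weakEquivalence {X Y : M} (f : X ⟶ Y) [Cofibration f] [WeakEquivalence f] :
    WeakEquivalence (G.map f)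

section LeftQuillen

variable {M N : Type*} [Category* M] [Category* N] [ModelCategory M] [ModelCategory N]

/-- Both left classes are determined by lifting properties, and lifting problems transpose across
the adjunction. -/
theorem IsLeftQuillen.of_rightAdjoint {G : M ⥤ N} {R : N ⥤ M} (adj : G ⊣ R)
    (h₁ : ∀ ⦃X Y : N⦄ (p : X ⟶ Y) [Fibration p], Fibration (R.map p))
    (h₂ : ∀ ⦃X Y : N⦄ (p : X ⟶ Y) [Fibration p] [WeakEquivalence p],
      WeakEquivalence (R.map p)) : IsLeftQuillen G := by
  have key {X Y : M} (f : X ⟶ Y) [Cofibration f] [WeakEquivalence f] :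
      trivialCofibrations N (G.map f) := by
    rw [← fibrations_llp]
    intro A B p hp
    have : Fibration p := ⟨hp⟩
    have := h₁ p
    rw [adj.hasLiftingProperty_iff]
    infer_instance
  refine ⟨fun f _ ↦ ?_, fun f _ _ ↦ ⟨(key f).2⟩⟩
  rw [cofibration_iff, ← trivialFibrations_llp]
  intro A B p hp
  obtain ⟨_, _⟩ := (mem_trivialFibrations_iff p).1 hp
  have := h₁ p
  have := h₂ p
  rw [adj.hasLiftingProperty_iff]
  infer_instance

namespace IsLeftQuillen

variable {G : M ⥤ N} (hG : IsLeftQuillen G)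
include hG

theorem comp {K : Type*} [Category* K] [ModelCategory K] {G' : N ⥤ K} (hG' : IsLeftQuillen G') :
    IsLeftQuillen (G ⋙ G') where
  cofibration f _ := by
    have := hG.cofibration f
    exact hG'.cofibration (G.map f)
  weakEquivalence f _ _ := by
    have := hG.cofibration f
    have := hG.weakEquivalence f
    exact hG'.weakEquivalence (G.map f)

/-- Ken Brown's lemma. -/
theorem weakEquivalence_map {X Y : M} (f : X ⟶ Y) [IsCofibrant X] [IsCofibrant Y]
    [WeakEquivalence f] : WeakEquivalence (G.map f) := by
  obtain ⟨h⟩ : Nonempty (CofibrantBrownFactorization f) := inferInstance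
  have h₁ := hG.weakEquivalence h.i
  have h₂ := hG.weakEquivalence h.s
  have h₃ : G.map h.s ≫ G.map h.p = 𝟙 _ := by rw [← G.map_comp, h.s_p, G.map_id]
  have : WeakEquivalence (G.map h.p) := weakEquivalence_of_precomp_of_fac h₃
  rw [← h.fac, G.map_comp]
  infer_instance

variable {R : N ⥤ M} (adj : G ⊣ R)
include adj

theorem fibration_map {X Y : N} (p : X ⟶ Y) [Fibration p] : Fibration (R.map p) := by
  rw [fibration_iff, ← trivialCofibrations_rlp]
  intro A B f hf
  obtain ⟨_, _⟩ := (mem_trivialCofibrations_iff f).1 hf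
  have := hG.cofibration f
  have := hG.weakEquivalence f
  rw [← adj.hasLiftingProperty_iff]
  infer_instance

theorem weakEquivalence_map_of_fibration {X Y : N} (p : X ⟶ Y) [Fibration p]
    [WeakEquivalence p] : WeakEquivalence (R.map p) := by
  suffices trivialFibrations M (R.map p) from ⟨this.2⟩
  rw [← cofibrations_rlp]
  intro A B f hf
  have : Cofibration f := ⟨hf⟩
  have := hG.cofibration f
  rw [← adj.hasLiftingProperty_iff]
  infer_instance

theorem isCofibrant (X : M) [IsCofibrant X] : IsCofibrant (G.obj X) := by
  have := adj.leftAdjoint_preservesColimits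
  rw [isCofibrant_iff_of_isInitial (G.map (initial.to X)) (initialIsInitial.isInitialObj G _)]
  exact hG.cofibration _

theorem isFibrant (Z : N) [IsFibrant Z] : IsFibrant (R.obj Z) := by
  have := adj.rightAdjoint_preservesLimits
  rw [isFibrant_iff_of_isTerminal (R.map (terminal.from Z))
    (terminalIsTerminal.isTerminalObj R _)]
  exact hG.fibration_map adj _

/-- The dual of Ken Brown's lemma. -/
theorem weakEquivalence_rightAdjoint_map {X Y : N} (f : X ⟶ Y) [IsFibrant X] [IsFibrant Y]
    [WeakEquivalence f] : WeakEquivalence (R.map f) := by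
  obtain ⟨h⟩ : Nonempty (FibrantBrownFactorization f) := inferInstance
  have h₁ := hG.weakEquivalence_map_of_fibration adj h.p
  have h₂ := hG.weakEquivalence_map_of_fibration adj h.r
  have h₃ : R.map h.i ≫ R.map h.r = 𝟙 _ := by rw [← R.map_comp, h.i_r, R.map_id]
  have : WeakEquivalence (R.map h.i) := weakEquivalence_of_postcomp_of_fac h₃
  rw [← h.fac, R.map_comp]
  infer_instance

section Ho

variable {H₁ H₂ : Type*} [Category* H₁] [Category* H₂]
  (L₁ : M ⥤ H₁) [L₁.IsLocalization (weakEquivalences M)]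
  (L₂ : N ⥤ H₂) [L₂.IsLocalization (weakEquivalences N)]

/-- Transposition preserves and reflects the homotopy relation. -/
theorem map_homEquiv_eq_iff {W : M} {Z : N} [IsCofibrant W] [IsFibrant Z]
    (f g : G.obj W ⟶ Z) :
    L₁.map (adj.homEquiv _ _ f) = L₁.map (adj.homEquiv _ _ g) ↔ L₂.map f = L₂.map g := by
  have := hG.isFibrant adj Z
  have := hG.isCofibrant adj W
  constructor
  · intro h
    rw [← LeftHomotopyRel.iff_map_eq] at h
    obtain ⟨P, _, ⟨h⟩⟩ := h.exists_good_cylinder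
    have := isCofibrant_of_cofibration P.i₀
    have := hG.weakEquivalence_map P.π
    have := isIso_map_of_weakEquivalence L₂ (G.map P.π)
    have e₀ : f = G.map P.i₀ ≫ (adj.homEquiv _ _).symm h.h := by
      rw [← adj.homEquiv_naturality_left_symm, h.h₀, Equiv.symm_apply_apply]
    have e₁ : g = G.map P.i₁ ≫ (adj.homEquiv _ _).symm h.h := by
      rw [← adj.homEquiv_naturality_left_symm, h.h₁, Equiv.symm_apply_apply]
    refine (congrArg L₂.map e₀).trans (Eq.trans ?_ (congrArg L₂.map e₁).symm)
    rw [L₂.map_comp, L₂.map_comp]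
    congr 1
    rw [← cancel_mono (L₂.map (G.map P.π)), ← L₂.map_comp, ← L₂.map_comp, ← G.map_comp,
      ← G.map_comp, P.i₀_π, P.i₁_π]
  · intro h
    rw [← RightHomotopyRel.iff_map_eq] at h
    obtain ⟨P, _, ⟨h⟩⟩ := h.exists_good_pathObject
    have := isFibrant_of_fibration P.p₀
    have := hG.weakEquivalence_rightAdjoint_map adj P.ι
    have := isIso_map_of_weakEquivalence L₁ (R.map P.ι)
    have e₀ : adj.homEquiv _ _ f = adj.homEquiv _ _ h.h ≫ R.map P.p₀ := by
      rw [← adj.homEquiv_naturality_right, h.h₀]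
    have e₁ : adj.homEquiv _ _ g = adj.homEquiv _ _ h.h ≫ R.map P.p₁ := by
      rw [← adj.homEquiv_naturality_right, h.h₁]
    refine (congrArg L₁.map e₀).trans (Eq.trans ?_ (congrArg L₁.map e₁).symm)
    rw [L₁.map_comp, L₁.map_comp]
    congr 1
    rw [← cancel_epi (L₁.map (R.map P.ι)), ← L₁.map_comp, ← L₁.map_comp, ← R.map_comp,
      ← R.map_comp, P.ι_p₀, P.ι_p₁]

/-- The adjunction bijection on maps in the homotopy categories. -/
theorem exists_hoEquiv (W : M) (Z : N) [IsCofibrant W] [IsFibrant Z] :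
    ∃ e : (L₂.obj (G.obj W) ⟶ L₂.obj Z) ≃ (L₁.obj W ⟶ L₁.obj (R.obj Z)),
      ∀ f : G.obj W ⟶ Z, e (L₂.map f) = L₁.map (adj.homEquiv _ _ f) := by
  have := hG.isFibrant adj Z
  have := hG.isCofibrant adj W
  have s₁ := map_surjective_of_isLocalization L₁ W (R.obj Z)
  have s₂ := map_surjective_of_isLocalization L₂ (G.obj W) Z
  -- A homotopy class is transposed through a chosen representative; `map_homEquiv_eq_iff` gives
  -- independence of the choice and injectivity.
  let φ (x : L₂.obj (G.obj W) ⟶ L₂.obj Z) : L₁.obj W ⟶ L₁.obj (R.obj Z) :=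
    L₁.map (adj.homEquiv _ _ (s₂ x).choose)
  have hφ (f : G.obj W ⟶ Z) : φ (L₂.map f) = L₁.map (adj.homEquiv _ _ f) :=
    (hG.map_homEquiv_eq_iff adj L₁ L₂ _ _).2 (s₂ (L₂.map f)).choose_spec
  refine ⟨Equiv.ofBijective φ ⟨?_, ?_⟩, hφ⟩
  · intro x y h
    obtain ⟨f, rfl⟩ := s₂ x
    obtain ⟨g, rfl⟩ := s₂ y
    rw [hφ, hφ] at h
    exact (hG.map_homEquiv_eq_iff adj L₁ L₂ _ _).1 h
  · intro x
    obtain ⟨f, rfl⟩ := s₁ x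
    exact ⟨L₂.map ((adj.homEquiv _ _).symm f), by rw [hφ, Equiv.apply_symm_apply]⟩

/-- Under the adjunction, postcomposition with `g` corresponds to postcomposition with `R g`. -/
theorem bijective_postcomp_iff (W : M) [IsCofibrant W] {X Y : N} [IsFibrant X] [IsFibrant Y]
    (g : X ⟶ Y) :
    (Function.Bijective fun x : L₂.obj (G.obj W) ⟶ L₂.obj X ↦ x ≫ L₂.map g) ↔
      Function.Bijective fun x : L₁.obj W ⟶ L₁.obj (R.obj X) ↦ x ≫ L₁.map (R.map g) := by
  have := hG.isCofibrant adj W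
  obtain ⟨e, he⟩ := hG.exists_hoEquiv adj L₁ L₂ W X
  obtain ⟨e', he'⟩ := hG.exists_hoEquiv adj L₁ L₂ W Y
  rw [← e'.bijective.of_comp_iff', ← Function.Bijective.of_comp_iff _ e.bijective]
  refine iff_of_eq (congrArg _ (funext fun x ↦ ?_))
  obtain ⟨f, rfl⟩ := map_surjective_of_isLocalization L₂ (G.obj W) X x
  simp only [Function.comp_apply, he, ← Functor.map_comp, he', adj.homEquiv_naturality_right]

end Ho

end IsLeftQuillen

/-- For two Quillen adjunctions and a compatible pair of a transformation `τ` of left adjoints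
and a transformation `σ` of right adjoints, `τ` is a weak equivalence on cofibrant objects iff
`σ` is a weak equivalence on fibrant objects. -/
theorem IsLeftQuillen.weakEquivalence_iff_of_mates {G G' : M ⥤ N} {R R' : N ⥤ M} (adj : G ⊣ R)
    (adj' : G' ⊣ R') (hG : IsLeftQuillen G) (hG' : IsLeftQuillen G')
    (τ : ∀ W, G.obj W ⟶ G'.obj W) (σ : ∀ Z, R'.obj Z ⟶ R.obj Z)
    (h : ∀ (W : M) (Z : N) (f : G'.obj W ⟶ Z),
      adj.homEquiv _ _ (τ W ≫ f) = adj'.homEquiv _ _ f ≫ σ Z) :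
    (∀ (W : M) [IsCofibrant W], WeakEquivalence (τ W)) ↔
      ∀ (Z : N) [IsFibrant Z], WeakEquivalence (σ Z) := by
  let L₁ := (weakEquivalences M).Q
  let L₂ := (weakEquivalences N).Q
  have key (W : M) (Z : N) [IsCofibrant W] [IsFibrant Z] :
      (Function.Bijective fun x : L₂.obj (G'.obj W) ⟶ L₂.obj Z ↦ L₂.map (τ W) ≫ x) ↔
        Function.Bijective fun x : L₁.obj W ⟶ L₁.obj (R'.obj Z) ↦ x ≫ L₁.map (σ Z) := by
    have := hG.isCofibrant adj W
    have := hG'.isCofibrant adj' W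
    obtain ⟨e, he⟩ := hG.exists_hoEquiv adj L₁ L₂ W Z
    obtain ⟨e', he'⟩ := hG'.exists_hoEquiv adj' L₁ L₂ W Z
    rw [← e.bijective.of_comp_iff', ← Function.Bijective.of_comp_iff _ e'.bijective]
    refine iff_of_eq (congrArg _ (funext fun x ↦ ?_))
    obtain ⟨f, rfl⟩ := map_surjective_of_isLocalization L₂ (G'.obj W) Z x
    simp only [Function.comp_apply, he', ← Functor.map_comp, he, h]
  constructor
  · intro hτ Z _
    refine weakEquivalence_of_bijective_postcomp L₁ _ fun W _ ↦ (key W Z).1 ?_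
    have := isIso_map_of_weakEquivalence L₂ (τ W)
    exact bijective_precomp_of_isIso _ _
  · intro hσ W _
    refine weakEquivalence_of_bijective_precomp L₂ _ fun Z _ ↦ (key W Z).2 ?_
    have := isIso_map_of_weakEquivalence L₁ (σ Z)
    exact bijective_postcomp_of_isIso _ _

end LeftQuillen

/-! ### Flat objects -/

section Symmetric

variable {V : Type u} [Category.{v} V] [MonoidalCategory V] [SymmetricCategory V]

theorem whiskerRight_eq_braiding_whiskerLeft {X Y : V} (f : X ⟶ Y) (A : V) :
    f ▷ A = (β_ X A).hom ≫ A ◁ f ≫ (β_ Y A).inv := by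
  simp

variable [MonoidalClosed V]

/-- The right adjoint `(ihom A)` of `- ⊗ A`, obtained by symmetry. -/
def tensorRightAdjunction (V : Type u) [Category.{v} V] [MonoidalCategory V]
    [SymmetricCategory V] [MonoidalClosed V] (A : V) : tensorRight A ⊣ ihom A :=
  (ihom.adjunction A).ofNatIsoLeft (BraidedCategory.tensorLeftIsoTensorRight A)

/-- Tensoring preserves initial objects in each variable. This identifies the pushout-product of ∅ →
A with g and the map A ⊗ g. -/
theorem isIso_whiskerLeft_of_isInitial {I X Y : V} (hI : IsInitial I) (g : X ⟶ Y) :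
    IsIso (I ◁ g) := by
  have h (Z : V) : IsInitial (I ⊗ Z) := by
    have : PreservesColimitsOfSize.{0, 0} (tensorRight Z) :=
      (tensorRightAdjunction V Z).leftAdjoint_preservesColimits
    exact hI.isInitialObj (tensorRight Z) _
  exact isIso_of_isInitial (h X) (h Y) _

end Symmetric

section Flat

variable {V : Type u} [Category.{v} V] [MonoidalCategory V] [ModelCategory V]

theorem IsFlatObject.isLeftQuillen {K : V} (hK : IsFlatObject K) :
    IsLeftQuillen (tensorLeft K) where
  cofibration f _ := (hK f inferInstance).1
  weakEquivalence f _ _ := (hK f inferInstance).2 inferInstance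

variable [SymmetricCategory V]

theorem IsFlatObject.isLeftQuillen_tensorRight {K : V} (hK : IsFlatObject K) :
    IsLeftQuillen (tensorRight K) where
  cofibration f _ := by
    have := (hK f inferInstance).1
    change Cofibration (f ▷ K)
    rw [whiskerRight_eq_braiding_whiskerLeft]
    infer_instance
  weakEquivalence f _ _ := by
    have := (hK f inferInstance).2 inferInstance
    change WeakEquivalence (f ▷ K)
    rw [whiskerRight_eq_braiding_whiskerLeft]
    infer_instance

variable [MonoidalClosed V]

variable [IsMonoidalModelCategory V]

/-- Cofibrant objects are flat. -/
theorem isFlatObject_of_isCofibrant (A : V) [IsCofibrant A] : IsFlatObject A := by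
  intro X Y g _
  obtain ⟨P, i, m, _, e, _, hm⟩ : ∃ (P : V) (i : A ⊗ X ⟶ P) (m : P ⟶ A ⊗ Y), IsIso i ∧
      i ≫ m = A ◁ g ∧ Cofibration m ∧ (WeakEquivalence g → WeakEquivalence m) := by
    let sq := Functor.PushoutObjObj.ofHasPushout (curriedTensor V) (initial.to A) g
    refine ⟨sq.pt, sq.inl, sq.ι, ?_, sq.inl_ι,
      IsMonoidalModelCategory.cofibration_pushoutProduct (initial.to A) g, fun _ ↦
      IsMonoidalModelCategory.weakEquivalence_pushoutProduct_right (initial.to A) g⟩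
    have : IsIso (((curriedTensor V).obj (⊥_ V)).map g) :=
      isIso_whiskerLeft_of_isInitial initialIsInitial g
    exact sq.isPushout.isIso_inl_of_isIso
  rw [← e]
  refine ⟨inferInstance, fun h ↦ ?_⟩
  have := hm h
  infer_instance

/-- Tensoring a flat object with a cofibrant replacement of the unit is a weak equivalence. -/
theorem IsFlatObject.weakEquivalence_whiskerLeft {K : V} (hK : IsFlatObject K) {Q : V}
    [IsCofibrant Q] (q : Q ⟶ 𝟙_ V) [WeakEquivalence q] : WeakEquivalence (K ◁ q) := by
  obtain ⟨K', _, p, _, _⟩ := CofibrantObject.HoCat.exists_resolution K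
  have hQ := isFlatObject_of_isCofibrant Q
  have : IsCofibrant (K ⊗ Q) := hK.isLeftQuillen.isCofibrant (ihom.adjunction K) Q
  have sq : CommSq (initial.to K') (initial.to (K ⊗ Q)) p (K ◁ q ≫ (ρ_ K).hom) :=
    ⟨Subsingleton.elim _ _⟩
  obtain ⟨s, hs⟩ : ∃ s : K ⊗ Q ⟶ K', s ≫ p = K ◁ q ≫ (ρ_ K).hom := ⟨sq.lift, sq.fac_right⟩
  -- The unit axiom for the cofibrant `K'` applies: after composing with the weak equivalence `p`,
  -- this map becomes `K' ◁ q` up to the unitor.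
  have h₁ : WeakEquivalence (p ▷ Q ≫ s) := by
    have : WeakEquivalence (K' ◁ q) := by
      have := IsMonoidalModelCategory.weakEquivalence_unit q (K := K')
      have e : K' ◁ q = (β_ K' Q).hom ≫ q ▷ K' ≫ (β_ (𝟙_ V) K').hom := by
        rw [BraidedCategory.braiding_naturality_left, SymmetricCategory.symmetry_assoc]
      rw [e]
      infer_instance
    have e : (p ▷ Q ≫ s) ≫ p = (K' ◁ q ≫ (ρ_ K').hom) ≫ p := by
      rw [Category.assoc, hs, ← whisker_exchange_assoc]
      simp
    exact weakEquivalence_of_postcomp_of_fac e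
  -- This composite is K applied to the weak equivalence Q ⊗ Q → Q between cofibrant objects, so
  -- flatness of K and Ken Brown's lemma suffice.
  have h₂ : WeakEquivalence (s ▷ Q ≫ p ▷ Q) := by
    have : IsCofibrant (Q ⊗ Q) := hQ.isLeftQuillen.isCofibrant (ihom.adjunction Q) Q
    have := IsMonoidalModelCategory.weakEquivalence_unit q (K := Q)
    have h : WeakEquivalence (K ◁ (q ▷ Q ≫ (λ_ Q).hom)) :=
      hK.isLeftQuillen.weakEquivalence_map (q ▷ Q ≫ (λ_ Q).hom)
    have e : s ▷ Q ≫ p ▷ Q = (α_ K Q Q).hom ≫ K ◁ (q ▷ Q ≫ (λ_ Q).hom) := by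
      rw [← comp_whiskerRight, hs]
      simp
    rw [e]
    infer_instance
  -- Two-out-of-six for K ⊗ Q ⊗ Q → K' ⊗ Q → K ⊗ Q → K'.
  have := weakEquivalence_of_two_out_of_six (s ▷ Q) (p ▷ Q) s
  have : WeakEquivalence s := weakEquivalence_of_precomp (p ▷ Q) s
  have : WeakEquivalence (K ◁ q ≫ (ρ_ K).hom) := by rw [← hs]; infer_instance
  exact weakEquivalence_of_postcomp (K ◁ q) (ρ_ K).hom

/-- Tensoring with a cofibrant object preserves weak equivalences between flat objects. -/
theorem IsFlatObject.weakEquivalence_whiskerRight {K K' : V} (hK : IsFlatObject K)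
    (hK' : IsFlatObject K') (f : K ⟶ K') [WeakEquivalence f] (A : V) [IsCofibrant A] :
    WeakEquivalence (f ▷ A) := by
  obtain ⟨Q, _, q, _, _⟩ := CofibrantObject.HoCat.exists_resolution (𝟙_ V)
  have hA := isFlatObject_of_isCofibrant A
  have h₁ := hK.weakEquivalence_whiskerLeft q
  have h₂ := hK'.weakEquivalence_whiskerLeft q
  have : IsCofibrant (K ⊗ Q) := hK.isLeftQuillen.isCofibrant (ihom.adjunction K) Q
  have : IsCofibrant (K' ⊗ Q) := hK'.isLeftQuillen.isCofibrant (ihom.adjunction K') Q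
  -- Tensoring with Q replaces K and K' by weakly equivalent cofibrant objects, so that Ken Brown's
  -- lemma for `- ⊗ A` becomes available.
  have h₃ : WeakEquivalence (f ▷ Q) := by
    have e : f ▷ Q ≫ K' ◁ q ≫ (ρ_ K').hom = (K ◁ q ≫ (ρ_ K).hom) ≫ f := by
      rw [← whisker_exchange_assoc]
      simp
    exact weakEquivalence_of_postcomp_of_fac e
  have h₄ : WeakEquivalence ((f ▷ Q) ▷ A) :=
    hA.isLeftQuillen_tensorRight.weakEquivalence_map (f ▷ Q)
  have : IsCofibrant (Q ⊗ A) :=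
    (isFlatObject_of_isCofibrant Q).isLeftQuillen.isCofibrant (ihom.adjunction Q) A
  have := IsMonoidalModelCategory.weakEquivalence_unit q (K := A)
  have h₅ : WeakEquivalence (K ◁ (q ▷ A ≫ (λ_ A).hom)) :=
    hK.isLeftQuillen.weakEquivalence_map (q ▷ A ≫ (λ_ A).hom)
  have h₆ : WeakEquivalence (K' ◁ (q ▷ A ≫ (λ_ A).hom)) :=
    hK'.isLeftQuillen.weakEquivalence_map (q ▷ A ≫ (λ_ A).hom)
  have e : ((α_ K Q A).hom ≫ K ◁ (q ▷ A ≫ (λ_ A).hom)) ≫ f ▷ A =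
      (f ▷ Q) ▷ A ≫ (α_ K' Q A).hom ≫ K' ◁ (q ▷ A ≫ (λ_ A).hom) := by
    rw [Category.assoc, whisker_exchange]
    simp
  exact weakEquivalence_of_precomp_of_fac e

/-- A weak equivalence between flat objects induces weak equivalences between internal homs to
fibrant objects. -/
theorem IsFlatObject.weakEquivalence_pre {K K' : V} (hK : IsFlatObject K)
    (hK' : IsFlatObject K') (f : K ⟶ K') [WeakEquivalence f] (Z : V) [IsFibrant Z] :
    WeakEquivalence ((MonoidalClosed.pre f).app Z) := by
  refine (IsLeftQuillen.weakEquivalence_iff_of_mates (ihom.adjunction K) (ihom.adjunction K')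
    hK.isLeftQuillen hK'.isLeftQuillen (fun A ↦ f ▷ A) (fun Z ↦ (MonoidalClosed.pre f).app Z)
    fun W Z g ↦ ?_).1 (fun A _ ↦ hK.weakEquivalence_whiskerRight hK' f A) Z
  exact (MonoidalClosed.curry_pre_app f g).symm

end Flat

namespace VPresheaf

/-! ### Evaluation of presheaves -/

section Evaluation

variable {V : Type u} [Category.{v} V] [MonoidalCategory V]
variable {C : Type w} [EnrichedCategory V C]

variable (V) in
/-- Evaluation at an object. -/
abbrev evaluation (c : C) : VPresheaf V C ⥤ V where
  obj X := X.obj c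
  map f := f.app c

/-- A `V`-natural transformation with invertible components is an isomorphism. -/
theorem isIso_of_app {X Y : VPresheaf V C} (f : X ⟶ Y) (h : ∀ c, IsIso (f.app c)) : IsIso f := by
  refine ⟨{ app c := inv (f.app c), naturality a b := ?_ }, ?_, ?_⟩
  · rw [← cancel_epi ((a ⟶[V] b) ◁ f.app b), ← f.naturality_assoc]
    simp [← MonoidalCategory.whiskerLeft_comp_assoc]
  · ext c; simp
  · ext c; simp

end Evaluation

/-! #### Limits and colimits of presheaves -/

section LimitsColimits

variable {V : Type u} [Category.{v} V] [MonoidalCategory V]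
variable {C : Type w} [EnrichedCategory V C] {J : Type*} [Category* J]
  (K : J ⥤ VPresheaf V C)

section

variable [HasLimitsOfShape J V]

/-- The value at `a` of the pointwise limit. -/
def limitObj (a : C) : V := limit (K ⋙ evaluation V a)

/-- The projections of the pointwise limit. -/
def limitπ (a : C) (j : J) : limitObj K a ⟶ (K.obj j).obj a := limit.π (K ⋙ evaluation V a) j

theorem limitπ_w (a : C) {i j : J} (f : i ⟶ j) :
    limitπ K a i ≫ (K.map f).app a = limitπ K a j :=
  limit.w (K ⋙ evaluation V a) f

variable {K} in
theorem limitObj_ext {a : C} {Z : V} {f g : Z ⟶ limitObj K a}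
    (h : ∀ j, f ≫ limitπ K a j = g ≫ limitπ K a j) : f = g :=
  limit.hom_ext h

/-- The universal property of the pointwise limit. -/
def limitLift {a : C} {Z : V} (φ : ∀ j, Z ⟶ (K.obj j).obj a)
    (hφ : ∀ ⦃i j⦄ (f : i ⟶ j), φ i ≫ (K.map f).app a = φ j) : Z ⟶ limitObj K a :=
  limit.lift (K ⋙ evaluation V a)
    ⟨Z, { app := φ, naturality _ _ f := (Category.id_comp _).trans (hφ f).symm }⟩

@[simp]
theorem limitLift_π {a : C} {Z : V} (φ : ∀ j, Z ⟶ (K.obj j).obj a)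
    (hφ : ∀ ⦃i j⦄ (f : i ⟶ j), φ i ≫ (K.map f).app a = φ j) (j : J) :
    limitLift K φ hφ ≫ limitπ K a j = φ j :=
  limit.lift_π _ _

/-- The action on the pointwise limit of a diagram of presheaves. -/
def limitAct (a b : C) : (a ⟶[V] b) ⊗ limitObj K b ⟶ limitObj K a :=
  limitLift K (fun j ↦ (a ⟶[V] b) ◁ limitπ K b j ≫ (K.obj j).act a b) (by
    intro i j f
    rw [Category.assoc, Hom.naturality, ← MonoidalCategory.whiskerLeft_comp_assoc, limitπ_w])

@[simp]
theorem limitAct_π (a b : C) (j : J) :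
    limitAct K a b ≫ limitπ K a j = (a ⟶[V] b) ◁ limitπ K b j ≫ (K.obj j).act a b :=
  limitLift_π _ _ _ _

/-- The pointwise limit of a diagram of presheaves. -/
abbrev pointwiseLimit : VPresheaf V C where
  obj a := limitObj K a
  act a b := limitAct K a b
  act_id a := by
    apply limitObj_ext
    intro j
    rw [Category.assoc, limitAct_π, ← whisker_exchange_assoc, act_id]
    simp
  act_comp a b c := by
    apply limitObj_ext
    intro j
    simp only [Category.assoc, limitAct_π]
    rw [← whisker_exchange_assoc, act_comp, ← MonoidalCategory.whiskerLeft_comp_assoc,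
      limitAct_π]
    simp

instance : HasLimitsOfShape J (VPresheaf V C) where
  has_limit K := ⟨⟨{
    cone :=
      { pt := pointwiseLimit K
        π :=
          { app j := { app a := limitπ K a j, naturality a b := limitAct_π K a b j }
            naturality i j f := hom_ext fun a ↦
              (Category.id_comp _).trans (limitπ_w K a f).symm } }
    isLimit :=
      { lift s :=
          { app a := limitLift K (fun j ↦ (s.π.app j).app a) fun i j f ↦
              congrArg (fun g ↦ Hom.app g a) (s.w f)
            naturality a b := by
              apply limitObj_ext
              intro j
              rw [Category.assoc, Category.assoc, limitAct_π, limitLift_π,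
                ← MonoidalCategory.whiskerLeft_comp_assoc, limitLift_π]
              exact (s.π.app j).naturality a b }
        fac s j := by
          ext a
          rw [comp_app, limitLift_π]
        uniq s m hm := by
          refine hom_ext fun a ↦ limitObj_ext fun j ↦ ?_
          rw [limitLift_π, ← hm]
          rfl } }⟩⟩

end

section

variable [HasColimitsOfShape J V]

/-- The value at `a` of the pointwise colimit. -/
def colimitObj (a : C) : V := colimit (K ⋙ evaluation V a)

/-- The coprojections of the pointwise colimit. -/
def colimitι (a : C) (j : J) : (K.obj j).obj a ⟶ colimitObj K a :=
  colimit.ι (K ⋙ evaluation V a) j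

theorem colimitι_w (a : C) {i j : J} (f : i ⟶ j) :
    (K.map f).app a ≫ colimitι K a j = colimitι K a i :=
  colimit.w (K ⋙ evaluation V a) f

variable {K} in
theorem colimitObj_ext {a : C} {Z : V} {f g : colimitObj K a ⟶ Z}
    (h : ∀ j, colimitι K a j ≫ f = colimitι K a j ≫ g) : f = g :=
  colimit.hom_ext h

/-- The universal property of the pointwise colimit. -/
def colimitDesc {a : C} {Z : V} (φ : ∀ j, (K.obj j).obj a ⟶ Z)
    (hφ : ∀ ⦃i j⦄ (f : i ⟶ j), (K.map f).app a ≫ φ j = φ i) : colimitObj K a ⟶ Z :=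
  colimit.desc (K ⋙ evaluation V a)
    ⟨Z, { app := φ, naturality _ _ f := (hφ f).trans (Category.comp_id _).symm }⟩

@[simp]
theorem ι_colimitDesc {a : C} {Z : V} (φ : ∀ j, (K.obj j).obj a ⟶ Z)
    (hφ : ∀ ⦃i j⦄ (f : i ⟶ j), (K.map f).app a ≫ φ j = φ i) (j : J) :
    colimitι K a j ≫ colimitDesc K φ hφ = φ j :=
  colimit.ι_desc _ _

variable [MonoidalClosed V]

variable {K} in
theorem whiskerLeft_colimitObj_ext {a : C} {A Z : V} {f g : A ⊗ colimitObj K a ⟶ Z}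
    (h : ∀ j, A ◁ colimitι K a j ≫ f = A ◁ colimitι K a j ≫ g) : f = g := by
  apply MonoidalClosed.curry_injective
  apply colimitObj_ext
  intro j
  rw [← MonoidalClosed.curry_natural_left, ← MonoidalClosed.curry_natural_left, h j]

/-- The action on the pointwise colimit of a diagram of presheaves. -/
def colimitAct (a b : C) : (a ⟶[V] b) ⊗ colimitObj K b ⟶ colimitObj K a :=
  MonoidalClosed.uncurry (colimitDesc K
    (fun j ↦ MonoidalClosed.curry ((K.obj j).act a b ≫ colimitι K a j)) (by
      intro i j f
      rw [← MonoidalClosed.curry_natural_left, ← Hom.naturality_assoc, colimitι_w]))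

theorem ι_colimitAct (a b : C) (j : J) :
    (a ⟶[V] b) ◁ colimitι K b j ≫ colimitAct K a b = (K.obj j).act a b ≫ colimitι K a j := by
  rw [colimitAct, ← MonoidalClosed.uncurry_natural_left, ι_colimitDesc,
    MonoidalClosed.uncurry_curry]

/-- The pointwise colimit of a diagram of presheaves. -/
abbrev pointwiseColimit : VPresheaf V C where
  obj a := colimitObj K a
  act a b := colimitAct K a b
  act_id a := by
    apply whiskerLeft_colimitObj_ext
    intro j
    rw [whisker_exchange_assoc, ι_colimitAct, reassoc_of% (K.obj j).act_id a,
      leftUnitor_naturality]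
  act_comp a b c := by
    apply whiskerLeft_colimitObj_ext
    intro j
    rw [whisker_exchange_assoc, ι_colimitAct, associator_naturality_right_assoc,
      ← MonoidalCategory.whiskerLeft_comp_assoc, ι_colimitAct,
      reassoc_of% (K.obj j).act_comp a b c, MonoidalCategory.whiskerLeft_comp_assoc,
      ι_colimitAct]

instance : HasColimitsOfShape J (VPresheaf V C) where
  has_colimit K := ⟨⟨{
    cocone :=
      { pt := pointwiseColimit K
        ι :=
          { app j := { app a := colimitι K a j, naturality a b := (ι_colimitAct K a b j).symm }
            naturality i j f := hom_ext fun a ↦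
              (colimitι_w K a f).trans (Category.comp_id _).symm } }
    isColimit :=
      { desc s :=
          { app a := colimitDesc K (fun j ↦ (s.ι.app j).app a) fun i j f ↦
              congrArg (fun g ↦ Hom.app g a) (s.w f)
            naturality a b := by
              apply whiskerLeft_colimitObj_ext
              intro j
              rw [reassoc_of% ι_colimitAct K a b j, ι_colimitDesc,
                ← MonoidalCategory.whiskerLeft_comp_assoc, ι_colimitDesc]
              exact (s.ι.app j).naturality a b }
        fac s j := by
          ext a
          rw [comp_app, ι_colimitDesc]
        uniq s m hm := by
          refine hom_ext fun a ↦ colimitObj_ext fun j ↦ ?_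
          rw [ι_colimitDesc, ← hm]
          rfl } }⟩⟩

instance [HasLimitsOfSize.{v, v} V] : HasLimitsOfSize.{v, v} (VPresheaf V C) where

instance [HasColimitsOfSize.{v, v} V] : HasColimitsOfSize.{v, v} (VPresheaf V C) where

end

end LimitsColimits

/-! #### Tensors with objects of the base, and free presheaves -/

section Tensor

variable {V : Type u} [Category.{v} V] [MonoidalCategory V]
variable {C : Type w} [EnrichedCategory V C]

/-- The presheaf `X ⊗ A`. -/
abbrev tensor (X : VPresheaf V C) (A : V) : VPresheaf V C where
  obj a := X.obj a ⊗ A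
  act a b := (α_ _ _ _).inv ≫ X.act a b ▷ A
  act_id a := by
    rw [associator_inv_naturality_left_assoc, ← comp_whiskerRight, act_id]
    simp
  act_comp a b c := by
    rw [associator_inv_naturality_left_assoc, ← comp_whiskerRight, act_comp]
    simp

/-- The functoriality of `X ⊗ A` in `X`. -/
abbrev tensorMapLeft {X Y : VPresheaf V C} (f : X ⟶ Y) (A : V) : tensor X A ⟶ tensor Y A where
  app a := f.app a ▷ A
  naturality a b := by
    rw [Category.assoc, ← comp_whiskerRight, f.naturality]
    simp

/-- The functoriality of `X ⊗ A` in `A`. -/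
abbrev tensorMapRight (X : VPresheaf V C) {A B : V} (f : A ⟶ B) : tensor X A ⟶ tensor X B where
  app a := X.obj a ◁ f
  naturality a b := by
    rw [Category.assoc, ← whisker_exchange]
    simp

/-- The functor `- ⊗ A`. -/
abbrev tensorFunctor (C : Type w) [EnrichedCategory V C] (A : V) :
    VPresheaf V C ⥤ VPresheaf V C where
  obj X := tensor X A
  map f := tensorMapLeft f A

/-- The Yoneda argument: naturality forces a map out of C(-, c) ⊗ A to be determined by its
restriction along the identity of c. -/
theorem act_eId (X : VPresheaf V C) {A : V} {c : C} (f : tensor (representable c) A ⟶ X) (a : C) :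
    f.app a = (a ⟶[V] c) ◁ ((λ_ A).inv ≫ eId V c ▷ A ≫ f.app c) ≫ X.act a c := by
  have h := f.naturality a c
  have h2 : (a ⟶[V] c) ◁ eId V c ≫ eComp V a c c = (ρ_ _).hom := by
    rw [← cancel_epi (ρ_ _).inv, e_comp_id, Iso.inv_hom_id]
  simp only [MonoidalCategory.whiskerLeft_comp, Category.assoc]
  rw [← h]
  simp only [Category.assoc]
  rw [associator_inv_naturality_middle_assoc, ← comp_whiskerRight_assoc, h2]
  simp

/-- The Yoneda bijection for the free presheaf `C(-, c) ⊗ A`. -/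
def freeEquiv (c : C) (A : V) (X : VPresheaf V C) :
    (tensor (representable c) A ⟶ X) ≃ (A ⟶ X.obj c) where
  toFun f := (λ_ A).inv ≫ eId V c ▷ A ≫ f.app c
  invFun g :=
    { app a := (a ⟶[V] c) ◁ g ≫ X.act a c
      naturality a b := by
        simp only [Category.assoc, MonoidalCategory.whiskerLeft_comp]
        rw [← whisker_exchange_assoc, act_comp]
        simp }
  left_inv f := by
    ext a
    exact (act_eId X f a).symm
  right_inv g := by
    dsimp only
    rw [← whisker_exchange_assoc, act_id]
    simp

theorem freeEquiv_apply (c : C) (A : V) (X : VPresheaf V C)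
    (f : tensor (representable c) A ⟶ X) :
    freeEquiv c A X f = (λ_ A).inv ≫ eId V c ▷ A ≫ f.app c := rfl

theorem freeEquiv_symm_apply_app (c : C) (A : V) (X : VPresheaf V C) (g : A ⟶ X.obj c) (a : C) :
    ((freeEquiv c A X).symm g).app a = (a ⟶[V] c) ◁ g ≫ X.act a c := rfl

/-- The functor `A ↦ C(-, c) ⊗ A`. -/
abbrev free (c : C) : V ⥤ VPresheaf V C where
  obj A := tensor (representable c) A
  map f := tensorMapRight _ f

/-- Free presheaves are left adjoint to evaluation. -/
def freeAdjunction (c : C) : free c ⊣ evaluation V c :=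
  Adjunction.mkOfHomEquiv
    { homEquiv A X := freeEquiv c A X
      homEquiv_naturality_left_symm f g := by
        ext a
        simp [freeEquiv_symm_apply_app]
      homEquiv_naturality_right f g := by
        simp [freeEquiv_apply] }

end Tensor

/-! #### Cofree presheaves -/

section Cofree

variable {V : Type u} [Category.{v} V] [MonoidalCategory V] [MonoidalClosed V]
variable {C : Type w} [EnrichedCategory V C]

/-- The action on the cofree presheaf. -/
def cofreeAct (c : C) (Z : V) (a b : C) :
    (a ⟶[V] b) ⊗ (ihom (c ⟶[V] b)).obj Z ⟶ (ihom (c ⟶[V] a)).obj Z :=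
  MonoidalClosed.curry ((α_ _ _ _).inv ≫ eComp V c a b ▷ _ ≫ (ihom.ev (c ⟶[V] b)).app Z)

theorem whiskerLeft_cofreeAct (c : C) (Z : V) (a b : C) :
    (c ⟶[V] a) ◁ cofreeAct c Z a b ≫ (ihom.ev (c ⟶[V] a)).app Z =
      (α_ _ _ _).inv ≫ eComp V c a b ▷ _ ≫ (ihom.ev (c ⟶[V] b)).app Z := by
  rw [← MonoidalClosed.uncurry_eq, cofreeAct, MonoidalClosed.uncurry_curry]

theorem ihom_hom_ext {A Y Z : V} {f g : Y ⟶ (ihom A).obj Z}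
    (h : A ◁ f ≫ (ihom.ev A).app Z = A ◁ g ≫ (ihom.ev A).app Z) : f = g :=
  MonoidalClosed.uncurry_injective (by simpa only [MonoidalClosed.uncurry_eq] using h)

/-- The cofree presheaf, with value `[C(c, a), Z]` at `a`. -/
abbrev cofreeObj (c : C) (Z : V) : VPresheaf V C where
  obj a := (ihom (c ⟶[V] a)).obj Z
  act a b := cofreeAct c Z a b
  act_id a := by
    apply ihom_hom_ext
    rw [MonoidalCategory.whiskerLeft_comp_assoc, whiskerLeft_cofreeAct]
    have h2 : (c ⟶[V] a) ◁ eId V a ≫ eComp V c a a = (ρ_ _).hom := by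
      rw [← cancel_epi (ρ_ _).inv, e_comp_id, Iso.inv_hom_id]
    rw [associator_inv_naturality_middle_assoc, ← comp_whiskerRight_assoc, h2]
    simp
  act_comp a b d := by
    apply ihom_hom_ext
    simp only [MonoidalCategory.whiskerLeft_comp, Category.assoc]
    rw [whiskerLeft_cofreeAct, whiskerLeft_cofreeAct, associator_inv_naturality_middle_assoc,
      ← comp_whiskerRight_assoc, ← e_assoc, associator_inv_naturality_right_assoc,
      whisker_exchange_assoc, whiskerLeft_cofreeAct]
    simp [-e_assoc, -e_assoc_assoc]

/-- The functor sending `Z` to the cofree presheaf. -/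
abbrev cofree (c : C) : V ⥤ VPresheaf V C where
  obj Z := cofreeObj c Z
  map f :=
    { app a := (ihom _).map f
      naturality a b := by
        apply ihom_hom_ext
        simp only [MonoidalCategory.whiskerLeft_comp, Category.assoc]
        rw [whiskerLeft_cofreeAct, ihom.ev_naturality, reassoc_of% whiskerLeft_cofreeAct,
          associator_inv_naturality_right_assoc, whisker_exchange_assoc, ihom.ev_naturality] }

/-- The bijection expressing the universal property of cofree presheaves. -/
def cofreeEquiv (c : C) (X : VPresheaf V C) (Z : V) :
    (X.obj c ⟶ Z) ≃ (X ⟶ cofreeObj c Z) where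
  toFun g :=
    { app a := MonoidalClosed.curry (X.act c a ≫ g)
      naturality a b := by
        apply ihom_hom_ext
        simp only [MonoidalCategory.whiskerLeft_comp, Category.assoc]
        rw [whiskerLeft_cofreeAct, associator_inv_naturality_right_assoc,
          whisker_exchange_assoc, ← MonoidalClosed.uncurry_eq, ← MonoidalClosed.uncurry_eq,
          MonoidalClosed.uncurry_curry, MonoidalClosed.uncurry_curry,
          reassoc_of% X.act_comp c a b]
        simp }
  invFun f := f.app c ≫ (λ_ _).inv ≫ eId V c ▷ _ ≫ (ihom.ev (c ⟶[V] c)).app Z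
  left_inv g := by
    dsimp only
    rw [leftUnitor_inv_naturality_assoc, whisker_exchange_assoc, ← MonoidalClosed.uncurry_eq,
      MonoidalClosed.uncurry_curry, reassoc_of% X.act_id c]
    simp
  right_inv f := by
    refine hom_ext fun a ↦ ?_
    apply ihom_hom_ext
    dsimp only
    rw [← MonoidalClosed.uncurry_eq, MonoidalClosed.uncurry_curry,
      reassoc_of% f.naturality c a]
    have h1 : eId V c ▷ (c ⟶[V] a) ≫ eComp V c c a = (λ_ _).hom :=
      (representable (V := V) a).act_id c
    rw [leftUnitor_inv_naturality_assoc, whisker_exchange_assoc, whiskerLeft_cofreeAct,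
      associator_inv_naturality_left_assoc, ← comp_whiskerRight_assoc, h1]
    simp

theorem cofreeEquiv_apply_app (c : C) (X : VPresheaf V C) (Z : V) (g : X.obj c ⟶ Z) (a : C) :
    (cofreeEquiv c X Z g).app a = MonoidalClosed.curry (X.act c a ≫ g) := rfl

theorem cofreeEquiv_symm_apply (c : C) (X : VPresheaf V C) (Z : V) (f : X ⟶ cofreeObj c Z) :
    (cofreeEquiv c X Z).symm f =
      f.app c ≫ (λ_ _).inv ≫ eId V c ▷ _ ≫ (ihom.ev (c ⟶[V] c)).app Z := rfl

/-- Evaluation is left adjoint to the cofree presheaf functor. -/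
def cofreeAdjunction (c : C) : evaluation V c ⊣ cofree c :=
  Adjunction.mkOfHomEquiv
    { homEquiv X Z := cofreeEquiv c X Z
      homEquiv_naturality_left_symm f g := by
        simp [cofreeEquiv_symm_apply]
      homEquiv_naturality_right f g := by
        ext a
        simp [cofreeEquiv_apply_app, MonoidalClosed.curry_natural_right] }

theorem cofreeAdjunction_homEquiv_app (c : C) (X : VPresheaf V C) (Z : V) (g : X.obj c ⟶ Z)
    (a : C) :
    ((cofreeAdjunction c).homEquiv X Z g).app a = MonoidalClosed.curry (X.act c a ≫ g) := by
  simp [cofreeAdjunction, cofreeEquiv_apply_app]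

instance (c : C) : PreservesColimitsOfSize.{v, v} (evaluation V c) :=
  (cofreeAdjunction c).leftAdjoint_preservesColimits

end Cofree

/-! #### Cotensors -/

section Cotensor

variable {V : Type u} [Category.{v} V] [MonoidalCategory V] [SymmetricCategory V]
  [MonoidalClosed V]
variable {C : Type w} [EnrichedCategory V C]

/-- Evaluation `[A, Z] ⊗ A ⟶ Z`. -/
def evRight (A Z : V) : (ihom A).obj Z ⊗ A ⟶ Z := (β_ _ _).hom ≫ (ihom.ev A).app Z

/-- The transpose `Y ⟶ [A, Z]` of a map `Y ⊗ A ⟶ Z`. -/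
def curryRight {A Y Z : V} (f : Y ⊗ A ⟶ Z) : Y ⟶ (ihom A).obj Z :=
  MonoidalClosed.curry ((β_ _ _).hom ≫ f)

theorem curryRight_evRight {A Y Z : V} (f : Y ⊗ A ⟶ Z) :
    curryRight f ▷ A ≫ evRight A Z = f := by
  rw [evRight, BraidedCategory.braiding_naturality_left_assoc, ← MonoidalClosed.uncurry_eq,
    curryRight, MonoidalClosed.uncurry_curry, SymmetricCategory.symmetry_assoc]

theorem ihom_hom_ext_right {A Y Z : V} {f g : Y ⟶ (ihom A).obj Z}
    (h : f ▷ A ≫ evRight A Z = g ▷ A ≫ evRight A Z) : f = g := by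
  apply ihom_hom_ext
  rw [evRight, BraidedCategory.braiding_naturality_left_assoc,
    BraidedCategory.braiding_naturality_left_assoc, cancel_epi] at h
  exact h

theorem evRight_naturality (A : V) {Y Z : V} (f : Y ⟶ Z) :
    (ihom A).map f ▷ A ≫ evRight A Z = evRight A Y ≫ f := by
  rw [evRight, BraidedCategory.braiding_naturality_left_assoc, ihom.ev_naturality, evRight,
    Category.assoc]

/-- The action on `[A, X]`. -/
def cotensorAct (A : V) (X : VPresheaf V C) (a b : C) :
    (a ⟶[V] b) ⊗ (ihom A).obj (X.obj b) ⟶ (ihom A).obj (X.obj a) :=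
  curryRight ((α_ _ _ _).hom ≫ (a ⟶[V] b) ◁ evRight A (X.obj b) ≫ X.act a b)

theorem cotensorAct_evRight (A : V) (X : VPresheaf V C) (a b : C) :
    cotensorAct A X a b ▷ A ≫ evRight A (X.obj a) =
      (α_ _ _ _).hom ≫ (a ⟶[V] b) ◁ evRight A (X.obj b) ≫ X.act a b :=
  curryRight_evRight _

/-- The presheaf `[A, X]`. -/
abbrev cotensor (A : V) (X : VPresheaf V C) : VPresheaf V C where
  obj a := (ihom A).obj (X.obj a)
  act a b := cotensorAct A X a b
  act_id a := by
    apply ihom_hom_ext_right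
    rw [comp_whiskerRight_assoc, cotensorAct_evRight, associator_naturality_left_assoc,
      ← whisker_exchange_assoc, act_id]
    simp
  act_comp a b c := by
    apply ihom_hom_ext_right
    simp only [comp_whiskerRight, Category.assoc]
    rw [cotensorAct_evRight, cotensorAct_evRight, associator_naturality_left_assoc,
      ← whisker_exchange_assoc, act_comp, associator_naturality_middle_assoc,
      ← MonoidalCategory.whiskerLeft_comp_assoc, cotensorAct_evRight]
    simp

/-- The functor `[A, -]`. -/
abbrev cotensorFunctor (C : Type w) [EnrichedCategory V C] (A : V) :
    VPresheaf V C ⥤ VPresheaf V C where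
  obj X := cotensor A X
  map f :=
    { app a := (ihom A).map (f.app a)
      naturality a b := by
        apply ihom_hom_ext_right
        simp only [comp_whiskerRight, Category.assoc]
        rw [evRight_naturality, reassoc_of% cotensorAct_evRight, cotensorAct_evRight, f.naturality,
          associator_naturality_middle_assoc,
          ← MonoidalCategory.whiskerLeft_comp_assoc _ (evRight A _),
          ← MonoidalCategory.whiskerLeft_comp_assoc _ (_ ▷ A), evRight_naturality] }

/-- The bijection expressing the universal property of `[A, Y]`. -/
def cotensorEquiv (A : V) (X Y : VPresheaf V C) : (tensor X A ⟶ Y) ≃ (X ⟶ cotensor A Y) where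
  toFun f :=
    { app a := curryRight (f.app a)
      naturality a b := by
        apply ihom_hom_ext_right
        simp only [comp_whiskerRight, Category.assoc]
        rw [cotensorAct_evRight, curryRight_evRight, associator_naturality_middle_assoc,
          ← MonoidalCategory.whiskerLeft_comp_assoc, curryRight_evRight, ← f.naturality]
        simp }
  invFun g :=
    { app a := g.app a ▷ A ≫ evRight A (Y.obj a)
      naturality a b := by
        rw [Category.assoc, ← comp_whiskerRight_assoc, g.naturality]
        simp [cotensorAct_evRight] }
  left_inv f := by
    ext a
    exact curryRight_evRight _
  right_inv g := by
    ext a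
    exact ihom_hom_ext_right (curryRight_evRight _)

theorem cotensorEquiv_apply_app (A : V) (X Y : VPresheaf V C) (f : tensor X A ⟶ Y) (a : C) :
    (cotensorEquiv A X Y f).app a = curryRight (f.app a) := rfl

theorem cotensorEquiv_symm_apply_app (A : V) (X Y : VPresheaf V C) (g : X ⟶ cotensor A Y)
    (a : C) :
    ((cotensorEquiv A X Y).symm g).app a = g.app a ▷ A ≫ evRight A (Y.obj a) := rfl

/-- The functor `[A, -]` is right adjoint to `- ⊗ A`. -/
def cotensorAdjunction (C : Type w) [EnrichedCategory V C] (A : V) :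
    tensorFunctor C A ⊣ cotensorFunctor C A :=
  Adjunction.mkOfHomEquiv
    { homEquiv X Y := cotensorEquiv A X Y
      homEquiv_naturality_left_symm f g := by
        ext a
        simp [cotensorEquiv_symm_apply_app]
      homEquiv_naturality_right f g := by
        ext a
        apply ihom_hom_ext_right
        simp [cotensorEquiv_apply_app, curryRight_evRight, evRight_naturality,
          reassoc_of% (curryRight_evRight (f.app a))] }

end Cotensor

/-! #### The projective model structure -/

section PointwiseClasses

variable {V : Type u} [Category.{v} V] [MonoidalCategory V]
variable {C : Type w} [EnrichedCategory V C] {X Y : VPresheaf V C}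

/-- The set of morphisms `C(-, c) ⊗ i` for `c` in `C` and `i` in `I`. -/
def freeMorphisms (C : Type w) [EnrichedCategory V C] (I : MorphismProperty V) :
    MorphismProperty (VPresheaf V C) :=
  .ofHoms fun x : C × I.toSet ↦ (free x.1).map x.2.1.hom

/-- Lifting against C(-, c) ⊗ i is lifting against i after evaluation at c. Hence generating sets of
V induce generating sets for the pointwise classes. -/
theorem freeMorphisms_rlp_iff (I : MorphismProperty V) (f : X ⟶ Y) :
    (freeMorphisms C I).rlp f ↔ ∀ c, I.rlp (f.app c) := by
  constructor
  · intro h c A B i hi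
    exact ((freeAdjunction c).hasLiftingProperty_iff i f).1
      (h _ (.mk (⟨c, Arrow.mk i, hi⟩ : C × I.toSet)))
  · rintro h _ _ _ ⟨c, i, hi⟩
    exact ((freeAdjunction c).hasLiftingProperty_iff i.hom f).2 (h c _ hi)

variable [ModelCategory V]

theorem weakEquivalence_iff_app (f : X ⟶ Y) :
    WeakEquivalence f ↔ ∀ c, WeakEquivalence (f.app c) :=
  weakEquivalence_iff f

theorem fibration_iff_app (f : X ⟶ Y) : Fibration f ↔ ∀ c, Fibration (f.app c) :=
  fibration_iff f

theorem trivialFibrations_iff_app (f : X ⟶ Y) :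
    trivialFibrations (VPresheaf V C) f ↔ ∀ c, trivialFibrations V (f.app c) := by
  simp only [mem_trivialFibrations_iff, weakEquivalence_iff_app, fibration_iff_app,
    forall_and]

instance weakEquivalence_app (f : X ⟶ Y) [hf : WeakEquivalence f] (c : C) :
    WeakEquivalence (f.app c) :=
  (weakEquivalence_iff_app f).1 hf c

instance fibration_app (f : X ⟶ Y) [hf : Fibration f] (c : C) : Fibration (f.app c) :=
  (fibration_iff_app f).1 hf c

instance : (weakEquivalences (VPresheaf V C)).HasTwoOutOfThreeProperty where
  comp_mem f g hf hg c := by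
    have := hf c
    have := hg c
    rw [comp_app]
    infer_instance
  of_postcomp f g hg hfg c := by
    have := hg c
    have : WeakEquivalence (f.app c ≫ g.app c) := hfg c
    exact weakEquivalence_of_postcomp (f.app c) (g.app c)
  of_precomp f g hf hfg c := by
    have := hf c
    have : WeakEquivalence (f.app c ≫ g.app c) := hfg c
    exact weakEquivalence_of_precomp (f.app c) (g.app c)

end PointwiseClasses

/-! ### Pointwise behaviour of projective cofibrations -/

section LocallyFlat

variable {V : Type u} [Category.{v} V] [MonoidalCategory V] [ModelCategory V]
  [MonoidalClosed V] {C : Type w} [EnrichedCategory V C] {X Y : VPresheaf V C}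

/-- Flatness of C(c, a) says that [C(c, a), -] is right Quillen. -/
theorem fibration_cofree_map (hC : IsLocallyFlat V C) (c : C) {A B : V} (p : A ⟶ B)
    [Fibration p] : Fibration ((cofree (V := V) c).map p) := by
  rw [fibration_iff_app]
  exact fun a ↦ (hC c a).isLeftQuillen.fibration_map (ihom.adjunction _) p

theorem weakEquivalence_cofree_map (hC : IsLocallyFlat V C) (c : C) {A B : V} (p : A ⟶ B)
    [Fibration p] [WeakEquivalence p] : WeakEquivalence ((cofree (V := V) c).map p) := by
  rw [weakEquivalence_iff_app]
  exact fun a ↦ (hC c a).isLeftQuillen.weakEquivalence_map_of_fibration (ihom.adjunction _) p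

/-- Lifting problems transpose along the adjunction between evaluation and cofree presheaves; local
flatness enters through the cofree side. This pointwise control allows smallness of domains to be
tested in V. -/
theorem trivialFibrations_llp_app (hC : IsLocallyFlat V C) (f : X ⟶ Y)
    (hf : (trivialFibrations (VPresheaf V C)).llp f) (c : C) : cofibrations V (f.app c) := by
  rw [← trivialFibrations_llp]
  intro A B p hp
  obtain ⟨_, _⟩ := (mem_trivialFibrations_iff p).1 hp
  have := fibration_cofree_map hC c p
  have := weakEquivalence_cofree_map hC c p
  exact ((cofreeAdjunction c).hasLiftingProperty_iff f p).2 (hf _ (mem_trivialFibrations _))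

theorem fibrations_llp_app (hC : IsLocallyFlat V C) (f : X ⟶ Y)
    (hf : (fibrations (VPresheaf V C)).llp f) (c : C) : trivialCofibrations V (f.app c) := by
  rw [← fibrations_llp]
  intro A B p hp
  have : Fibration p := ⟨hp⟩
  have := fibration_cofree_map hC c p
  exact ((cofreeAdjunction c).hasLiftingProperty_iff f p).2 (hf _ (mem_fibrations _))

end LocallyFlat

/-! ### Small object argument and existence of the projective model structure -/

section SmallObject

variable {V : Type u} [Category.{v} V] [MonoidalCategory V] [MonoidalClosed V]
  [HasColimitsOfSize.{v, v} V] {C : Type v} [EnrichedCategory V C]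

/-- Free presheaves on small objects are small. -/
theorem hasSmallObjectArgument_freeMorphisms (I S : MorphismProperty V)
    [MorphismProperty.IsSmall.{v} I]
    (hI : ∀ ⦃A B : V⦄ (i : A ⟶ B), I i → IsSmallRelativeTo A S)
    (hS : ∀ c, (freeMorphisms C I).rlp.llp ≤ S.inverseImage (evaluation V c)) :
    (freeMorphisms C I).HasSmallObjectArgument.{v} := by
  choose κ hκ using fun i : I.toSet ↦ hI i.1.hom i.2
  -- A successor of an infinite cardinal is regular, and the smallness of I allows one such cardinal
  -- to dominate the bounds for all domains.
  let κ₀ : Cardinal.{v} := max Cardinal.aleph0 (⨆ i, κ i)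
  have hκ₀ (i : I.toSet) : κ i ≤ Order.succ κ₀ :=
    (le_ciSup Cardinal.bddAbove_of_small i).trans
      ((le_max_right _ _).trans (Order.le_succ κ₀))
  have : Fact (Order.succ κ₀).IsRegular := ⟨Cardinal.isRegular_succ (le_max_left _ _)⟩
  have : Nonempty (Order.succ κ₀).ord.ToType := by simp
  let : OrderBot (Order.succ κ₀).ord.ToType := WellFoundedLT.toOrderBot _
  refine ⟨Order.succ κ₀, inferInstance, inferInstance, ?_⟩
  have : MorphismProperty.IsSmall.{v} (freeMorphisms C I) := by
    unfold freeMorphisms; infer_instance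
  refine { preservesColimit := ?_ }
  rintro _ _ X Y _ ⟨c, i, hi⟩ f hf
  -- Each successor map is a pushout of coproducts of free morphisms, hence has the left lifting
  -- property against their right class; `hS` puts its value at c in S.
  let h₁ : (S.inverseImage (evaluation V c)).TransfiniteCompositionOfShape
      (Order.succ κ₀).ord.ToType f :=
    { toTransfiniteCompositionOfShape := hf.toTransfiniteCompositionOfShape
      map_mem j hj := hS c _ (by
        have h := MorphismProperty.pushouts_le_llp_rlp _ _
          (hf.attachCells j hj).pushouts_coproducts
        rwa [MorphismProperty.rlp_coproducts, MorphismProperty.ofHoms_homFamily] at h) }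
  have : PreservesWellOrderContinuousOfShape (Order.succ κ₀).ord.ToType
    (evaluation (C := C) V c) := { }
  -- Maps out of the free presheaf on A are maps from A to the value at c. Evaluation preserves the
  -- colimit, so smallness of A in V is all that is needed.
  have : PreservesColimit (hf.F ⋙ evaluation V c) (coyoneda.obj (Opposite.op i.left)) :=
    hκ ⟨i, hi⟩ _ (hκ₀ _) inferInstance inferInstance inferInstance _ _ _
      (h₁.map (F := evaluation V c))
  have : PreservesColimit hf.F
      (evaluation V c ⋙ coyoneda.obj (Opposite.op i.left)) := inferInstance
  exact preservesColimit_of_natIso (F := evaluation V c ⋙ coyoneda.obj (Opposite.op i.left)) _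
    ((freeAdjunction c).compCoyonedaIso.app (Opposite.op i.left)).symm

variable [ModelCategory V]

variable (V C) in
/-- The weak factorization system of cofibrations and trivial fibrations. -/
theorem isWeakFactorizationSystem_cofibrations (hV : IsCofibrantlyGenerated V)
    (hC : IsLocallyFlat V C) : MorphismProperty.IsWeakFactorizationSystem
      (cofibrations (VPresheaf V C)) (trivialFibrations (VPresheaf V C)) := by
  obtain ⟨I, J, _, _, hI, -, hI', -⟩ := hV
  have h : trivialFibrations (VPresheaf V C) = (freeMorphisms C I).rlp := by
    ext X Y f
    rw [freeMorphisms_rlp_iff, trivialFibrations_iff_app, hI]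
  have h' : cofibrations (VPresheaf V C) = (freeMorphisms C I).rlp.llp := by
    rw [← h]; rfl
  have := hasSmallObjectArgument_freeMorphisms (C := C) I (cofibrations V) hI' fun c X Y f hf ↦
    trivialFibrations_llp_app hC f (by rwa [h]) c
  rw [h, h']
  exact
    { rlp := MorphismProperty.rlp_llp_rlp _
      llp := rfl }

variable (V C) in
/-- The weak factorization system of trivial cofibrations and fibrations. -/
theorem isWeakFactorizationSystem_trivialCofibrations (hV : IsCofibrantlyGenerated V)
    (hC : IsLocallyFlat V C) : MorphismProperty.IsWeakFactorizationSystem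
      (trivialCofibrations (VPresheaf V C)) (fibrations (VPresheaf V C)) := by
  obtain ⟨I, J, _, _, -, hJ, -, hJ'⟩ := hV
  have h : fibrations (VPresheaf V C) = (freeMorphisms C J).rlp := by
    ext X Y f
    rw [freeMorphisms_rlp_iff, ← fibration_iff, fibration_iff_app, ← hJ]
    simp only [fibration_iff]
  have := hasSmallObjectArgument_freeMorphisms (C := C) J (trivialCofibrations V) hJ'
    fun c X Y f hf ↦ fibrations_llp_app hC f (by rwa [h]) c
  have h' : trivialCofibrations (VPresheaf V C) = (freeMorphisms C J).rlp.llp := by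
    rw [← h]
    apply le_antisymm
    · intro X Y f hf
      -- Retract argument: the first factor is pointwise a trivial cofibration, so the second is a
      -- trivial fibration by two-out-of-three, and `f` lifts against it.
      have fac := MorphismProperty.factorizationData (freeMorphisms C J).rlp.llp
        (freeMorphisms C J).rlp f
      have h₁ : (fibrations (VPresheaf V C)).llp fac.i := by rw [h]; exact fac.hi
      have h₂ : fibrations (VPresheaf V C) fac.p := by rw [h]; exact fac.hp
      have h₃ : WeakEquivalence fac.i :=
        (weakEquivalence_iff_app _).2 fun c ↦ ⟨(fibrations_llp_app hC _ h₁ c).2⟩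
      have h₄ : WeakEquivalence f := ⟨hf.2⟩
      have h₅ : WeakEquivalence fac.p := weakEquivalence_of_precomp_of_fac fac.fac
      have : HasLiftingProperty f fac.p := hf.1 _ ⟨h₂, h₅.mem⟩
      exact MorphismProperty.of_retract (RetractArrow.ofLeftLiftingProperty fac.fac) h₁
    · intro X Y f hf
      exact ⟨MorphismProperty.antitone_llp (trivialFibrations_sub_fibrations _) _ hf,
        fun c ↦ ⟨(fibrations_llp_app hC f hf c).2⟩⟩
  rw [h, h']
  exact
    { rlp := MorphismProperty.rlp_llp_rlp _
      llp := rfl }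

variable (V C) in
/-- The projective model structure on `[Cᵒᵖ, V]`. -/
abbrev modelCategory [HasLimitsOfSize.{v, v} V] (hV : IsCofibrantlyGenerated V)
    (hC : IsLocallyFlat V C) : ModelCategory (VPresheaf V C) :=
  have := isWeakFactorizationSystem_cofibrations V C hV hC
  have := isWeakFactorizationSystem_trivialCofibrations V C hV hC
  have : HasFiniteLimits (VPresheaf V C) :=
    hasFiniteLimits_of_hasLimitsOfSize.{v, v} _
  have : HasFiniteColimits (VPresheaf V C) :=
    hasFiniteColimits_of_hasColimitsOfSize.{v, v} _
  ModelCategory.mk' _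

end SmallObject

/-! #### The universal property of `F_!` -/

section ExtensionIso

variable {V : Type u} [Category.{v} V] [MonoidalCategory V] [HasColimitsOfSize.{v, v} V]
  [MonoidalClosed V] {D : Type v} [EnrichedCategory V D] {C : Type w} [EnrichedCategory V C]
  {F : EnrichedFunctor V D C} {W : VPresheaf V D} {X : VPresheaf V C}

theorem extEquiv_extHomDesc_comp (g : W ⟶ restrict F X) {Y : VPresheaf V C} (f : X ⟶ Y) :
    extEquiv F W Y (extHomDesc g ≫ f) = g ≫ restrictMap F f := by
  have h : extUnit F W ≫ restrictMap F (extHomDesc g) = g := (extEquiv F W X).right_inv g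
  conv_rhs => rw [← h, Category.assoc]
  rfl

theorem extHomDesc_comp (g : W ⟶ restrict F X) {Y : VPresheaf V C} (f : X ⟶ Y) :
    extHomDesc (g ≫ restrictMap F f) = extHomDesc g ≫ f :=
  (extEquiv F W Y).symm_apply_eq.2 (extEquiv_extHomDesc_comp g f).symm

/-- By Yoneda, X is F_! W via g exactly when g is universal among maps from W to restrictions.
Identifications of F_! then need no computation with coends. -/
theorem isIso_extHomDesc_iff (g : W ⟶ restrict F X) : IsIso (extHomDesc g) ↔
    ∀ Y, Function.Bijective fun f : X ⟶ Y ↦ g ≫ restrictMap F f := by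
  simp only [← extEquiv_extHomDesc_comp]
  constructor
  · intro _ Y
    exact (extEquiv F W Y).bijective.comp (bijective_precomp_of_isIso (extHomDesc g) Y)
  · intro h
    exact isIso_of_coyoneda_map_bijective _ fun Y ↦
      (Function.Bijective.of_comp_iff' (extEquiv F W Y).bijective _).1 (h Y)

theorem bijective_extUnit_comp (F : EnrichedFunctor V D C) (W : VPresheaf V D)
    (Y : VPresheaf V C) :
    Function.Bijective fun f : extend F W ⟶ Y ↦ extUnit F W ≫ restrictMap F f :=
  (extEquiv F W Y).bijective

/-- The comparison of `D(-, d) ⊗ A` with the restriction of `C(-, F d) ⊗ A`. -/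
abbrev freeRestrict (F : EnrichedFunctor V D C) (d : D) (A : V) :
    tensor (representable d) A ⟶ restrict F (tensor (representable (F.obj d)) A) where
  app a := F.map a d ▷ A
  naturality a b := by
    simp only [Category.assoc]
    rw [← comp_whiskerRight, F.map_comp, MonoidalCategory.tensorHom_def']
    simp

/-- F_!(D(-, d) ⊗ A) ≅ C(-, F d) ⊗ A, since maps from either side to Y are maps A → Y(F d). -/
instance (F : EnrichedFunctor V D C) (d : D) (A : V) :
    IsIso (extHomDesc (freeRestrict F d A)) := by
  rw [isIso_extHomDesc_iff]
  intro Y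
  rw [← Function.Bijective.of_comp_iff' (freeEquiv d A (restrict F Y)).bijective]
  convert (freeEquiv (F.obj d) A Y).bijective using 1
  ext f
  simp only [Function.comp, freeEquiv_apply, comp_app]
  rw [← comp_whiskerRight_assoc, F.map_id]

end ExtensionIso

/-! ### Compatibility of F_! with tensors -/

section ExtensionTensor

variable {V : Type u} [Category.{v} V] [MonoidalCategory V]
  {D : Type*} [EnrichedCategory V D] {C : Type w} [EnrichedCategory V C]
  (F : EnrichedFunctor V D C)

/-- Restriction commutes with tensors. -/
abbrev restrictTensor (X : VPresheaf V C) (A : V) :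
    tensor (restrict F X) A ⟶ restrict F (tensor X A) where
  app a := 𝟙 _
  naturality a b := by simp

variable [SymmetricCategory V] [MonoidalClosed V]

/-- Restriction commutes with cotensors. -/
abbrev restrictCotensor (A : V) (Y : VPresheaf V C) :
    cotensor A (restrict F Y) ⟶ restrict F (cotensor A Y) where
  app a := 𝟙 _
  naturality a b := by
    apply ihom_hom_ext_right
    simp [cotensorAct_evRight, whisker_exchange_assoc]

instance (A : V) (Y : VPresheaf V C) : IsIso (restrictCotensor F A Y) :=
  isIso_of_app _ fun _ ↦ inferInstance

theorem cotensorEquiv_restrict {W : VPresheaf V D} {X Y : VPresheaf V C} {A : V}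
    (g : W ⟶ restrict F X) (f : tensor X A ⟶ Y) :
    cotensorEquiv A _ _ (tensorMapLeft g A ≫ restrictTensor F X A ≫ restrictMap F f) ≫
      restrictCotensor F A Y = g ≫ restrictMap F (cotensorEquiv A X Y f) := by
  ext d
  apply ihom_hom_ext_right
  simp [cotensorEquiv_apply_app, curryRight_evRight]

/-- Maps X ⊗ A → Y are maps X → [A, Y], and restriction commutes with cotensors. The universal
property tested on [A, Y] therefore gives the one for X ⊗ A. -/
theorem bijective_tensor_of_bijective {W : VPresheaf V D} {X : VPresheaf V C}
    (g : W ⟶ restrict F X) (A : V)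
    (h : ∀ Y, Function.Bijective fun f : X ⟶ Y ↦ g ≫ restrictMap F f) (Y : VPresheaf V C) :
    Function.Bijective fun f : tensor X A ⟶ Y ↦
      (tensorMapLeft g A ≫ restrictTensor F X A) ≫ restrictMap F f := by
  have h₁ := (h (cotensor A Y)).comp (cotensorEquiv A X Y).bijective
  have h₂ := (bijective_postcomp_of_isIso (restrictCotensor F A Y) W).comp
    (cotensorEquiv A W (restrict F Y)).bijective
  rw [← Function.Bijective.of_comp_iff' h₂]
  convert h₁ using 1
  ext1 f
  exact (congrArg (fun x ↦ cotensorEquiv A W (restrict F Y) x ≫ restrictCotensor F A Y)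
    (Category.assoc _ _ _)).trans (cotensorEquiv_restrict F g f)

end ExtensionTensor

/-- F_!(W ⊗ A) ≅ F_! W ⊗ A. -/
instance {V : Type u} [Category.{v} V] [MonoidalCategory V] [SymmetricCategory V]
    [MonoidalClosed V] [HasColimitsOfSize.{v, v} V] {D : Type v} [EnrichedCategory V D]
    {C : Type w} [EnrichedCategory V C] (F : EnrichedFunctor V D C) (W : VPresheaf V D) (A : V) :
    IsIso (extHomDesc (tensorMapLeft (extUnit F W) A ≫ restrictTensor F (extend F W) A)) :=
  (isIso_extHomDesc_iff _).2
    (bijective_tensor_of_bijective F (extUnit F W) A (bijective_extUnit_comp F W))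

section TensorUnit

variable {V : Type u} [Category.{v} V] [MonoidalCategory V] {C : Type w} [EnrichedCategory V C]

/-- The right unitor `X ⊗ 𝟙 ⟶ X`. -/
abbrev tensorUnit (X : VPresheaf V C) : tensor X (𝟙_ V) ⟶ X where
  app a := (ρ_ (X.obj a)).hom
  naturality a b := by simp

instance (X : VPresheaf V C) : IsIso (tensorUnit X) :=
  isIso_of_app _ fun _ ↦ inferInstance

theorem tensorUnit_comp_restrictMap {D : Type*} [EnrichedCategory V D]
    (F : EnrichedFunctor V D C) {W : VPresheaf V D} {X Y : VPresheaf V C}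
    (g : W ⟶ restrict F X) (f : X ⟶ Y) : tensorUnit W ≫ g ≫ restrictMap F f =
      (tensorMapLeft g (𝟙_ V) ≫ restrictTensor F X (𝟙_ V)) ≫ restrictMap F (tensorUnit X ≫ f) := by
  ext d
  simp

end TensorUnit

/-! #### The enriched Yoneda lemma and weighted colimits of representables -/

section Weighted

variable {V : Type u} [Category.{v} V] [MonoidalCategory V] [MonoidalClosed V]
  [HasLimitsOfSize.{v, v} V] {C : Type v} [EnrichedCategory V C]

/-- The universal property of the objects of `V`-natural transformations. -/
def homObjEquiv (X Y : VPresheaf V C) (A : V) : (A ⟶ homObj X Y) ≃ (tensor X A ⟶ Y) where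
  toFun g :=
    { app a := X.obj a ◁ g ≫ homEv X Y a
      naturality a b := by
        rw [Category.assoc, ← whisker_exchange_assoc, homEv_naturality]
        simp }
  invFun f := homLift f.app fun a b ↦ by
    rw [← f.naturality, Category.assoc, Iso.hom_inv_id_assoc]
  left_inv g := homObj_ext fun a ↦ homLift_homEv _ _ a
  right_inv f := hom_ext fun a ↦ homLift_homEv _ _ a

theorem homObjEquiv_apply_app (X Y : VPresheaf V C) (A : V) (g : A ⟶ homObj X Y) (a : C) :
    (homObjEquiv X Y A g).app a = X.obj a ◁ g ≫ homEv X Y a := rfl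

/-- Evaluation at the identity of `c`. -/
def yonedaEv (c : C) (X : VPresheaf V C) : homObj (representable c) X ⟶ X.obj c :=
  (λ_ _).inv ≫ eId V c ▷ _ ≫ homEv (representable c) X c

theorem freeEquiv_homObjEquiv (c : C) (X : VPresheaf V C) {A : V}
    (g : A ⟶ homObj (representable c) X) :
    freeEquiv c A X (homObjEquiv _ X A g) = g ≫ yonedaEv c X := by
  rw [freeEquiv_apply, homObjEquiv_apply_app, yonedaEv, leftUnitor_inv_naturality_assoc,
    whisker_exchange_assoc]

/-- The enriched Yoneda lemma: both sides represent maps C(-, c) ⊗ A → X as A varies. -/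
instance (c : C) (X : VPresheaf V C) : IsIso (yonedaEv c X) := by
  refine isIso_of_yoneda_map_bijective _ fun A ↦ ?_
  simp only [← freeEquiv_homObjEquiv]
  exact (freeEquiv c A X).bijective.comp (homObjEquiv _ X A).bijective

theorem homEv_representable (a c : C) (X : VPresheaf V C) :
    homEv (representable c) X a = (a ⟶[V] c) ◁ yonedaEv c X ≫ X.act a c := by
  have h := act_eId X (homObjEquiv (representable c) X _ (𝟙 _)) a
  simp only [homObjEquiv_apply_app, MonoidalCategory.whiskerLeft_id, Category.id_comp] at h
  exact h

theorem homComp_yonedaEv (c : C) (X Y : VPresheaf V C) :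
    homComp (representable c) X Y ≫ yonedaEv c Y =
      yonedaEv c X ▷ homObj X Y ≫ homEv X Y c := by
  have h : (c ⟶[V] c) ◁ homComp (representable c) X Y ≫ homEv (representable c) Y c =
      (α_ _ _ _).inv ≫ homEv (representable c) X c ▷ _ ≫ homEv X Y c :=
    homComp_homEv (representable c) X Y c
  rw [yonedaEv, leftUnitor_inv_naturality_assoc, whisker_exchange_assoc, h, yonedaEv]
  simp

/-- Naturality in the representing object of the Yoneda isomorphism, as needed to make it a map of
presheaves in `yonedaRestrict`. -/
theorem yonedaMap_homComp_yonedaEv (a b : C) (X : VPresheaf V C) :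
    yonedaMap a b ▷ homObj (representable b) X ≫
      homComp (representable a) (representable b) X ≫ yonedaEv a X =
        (a ⟶[V] b) ◁ yonedaEv b X ≫ X.act a b := by
  have h₁ : eId V a ▷ (a ⟶[V] b) ≫ eComp V a a b = (λ_ _).hom :=
    (representable (V := V) b).act_id a
  have h₂ : yonedaMap a b ≫ yonedaEv a (representable b) = 𝟙 (a ⟶[V] b) := by
    rw [yonedaEv, leftUnitor_inv_naturality_assoc, whisker_exchange_assoc, yonedaMap_homEv, h₁,
      Iso.inv_hom_id]
  rw [homComp_yonedaEv, ← comp_whiskerRight_assoc, h₂, homEv_representable, id_whiskerRight,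
    Category.id_comp]

/-- The restriction of the representable presheaf `[Cᵒᵖ, V](-, X)` along the Yoneda embedding is
`X`. -/
abbrev yonedaRestrict {D : Type*} [EnrichedCategory V D] (F : EnrichedFunctor V D C)
    (X : VPresheaf V C) :
    restrict (F.comp V yoneda) (representable X) ⟶ restrict F X where
  app d := yonedaEv (F.obj d) X
  naturality d e := by
    change ((F.map d e ≫ yonedaMap (F.obj d) (F.obj e)) ▷ homObj (representable (F.obj e)) X ≫
      homComp (representable (F.obj d)) (representable (F.obj e)) X) ≫ yonedaEv (F.obj d) X =
        (d ⟶[V] e) ◁ yonedaEv (F.obj e) X ≫ F.map d e ▷ X.obj (F.obj e) ≫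
          X.act (F.obj d) (F.obj e)
    rw [whisker_exchange_assoc, ← yonedaMap_homComp_yonedaEv]
    simp

instance {D : Type*} [EnrichedCategory V D] (F : EnrichedFunctor V D C) (X : VPresheaf V C) :
    IsIso (yonedaRestrict F X) :=
  isIso_of_app _ fun _ ↦ inferInstanceAs (IsIso (yonedaEv _ X))

variable {D : Type v} [EnrichedCategory V D] (F : EnrichedFunctor V D C)

/-- On A-valued points, and modulo Yoneda, the comparison map for ξ is composition with the cocone
tensored by A. -/
theorem weightedComparison_yoneda {W : VPresheaf V D} {X : VPresheaf V C}
    (ξ : W ⟶ restrict (F.comp V yoneda) (representable X)) (Y : VPresheaf V C) {A : V}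
    (f : A ⟶ homObj X Y) :
    homObjEquiv W _ A (f ≫ weightedComparison W (F.comp V yoneda) ξ Y) ≫ yonedaRestrict F Y =
      tensorMapLeft (ξ ≫ yonedaRestrict F X) A ≫ restrictTensor F X A ≫
        restrictMap F (homObjEquiv X Y A f) := by
  ext d
  have h : W.obj d ◁ weightedComparison W (F.comp V yoneda) ξ Y ≫
      homEv W (restrict (F.comp V yoneda) (representable Y)) d =
        ξ.app d ▷ homObj X Y ≫ homComp (representable (F.obj d)) X Y :=
    homLift_homEv _ _ d
  have h' (x : W.obj d ⟶ homObj (representable (F.obj d)) X) :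
      (W.obj d ◁ f ≫ x ▷ homObj X Y ≫ homComp (representable (F.obj d)) X Y) ≫
        yonedaEv (F.obj d) Y =
      (x ≫ yonedaEv (F.obj d) X) ▷ A ≫ 𝟙 _ ≫ X.obj (F.obj d) ◁ f ≫ homEv X Y (F.obj d) := by
    rw [Category.assoc, Category.assoc, homComp_yonedaEv, whisker_exchange_assoc,
      Category.id_comp, whisker_exchange_assoc, comp_whiskerRight_assoc]
  refine Eq.trans (congrArg (· ≫ yonedaEv (F.obj d) Y) ?_) (h' (ξ.app d))
  rw [homObjEquiv_apply_app, MonoidalCategory.whiskerLeft_comp, Category.assoc, h]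
  rfl

variable [SymmetricCategory V]

/-- A cocone `ξ` exhibits `X` as the colimit `W ⋆_D y_C F` if and only if the corresponding map
`F_! W ⟶ X` is an isomorphism. -/
theorem isWeightedColimit_iff [HasColimitsOfSize.{v, v} V] {W : VPresheaf V D}
    {X : VPresheaf V C} (ξ : W ⟶ restrict (F.comp V yoneda) (representable X)) :
    IsWeightedColimit W (F.comp V yoneda) X ξ ↔ IsIso (extHomDesc (ξ ≫ yonedaRestrict F X)) := by
  rw [isIso_extHomDesc_iff]
  have key (Y : VPresheaf V C) (A : V) : (Function.Bijective fun f : A ⟶ homObj X Y ↦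
      f ≫ weightedComparison W (F.comp V yoneda) ξ Y) ↔
      Function.Bijective fun f : tensor X A ⟶ Y ↦
        (tensorMapLeft (ξ ≫ yonedaRestrict F X) A ≫ restrictTensor F X A) ≫ restrictMap F f := by
    have h₁ := (bijective_postcomp_of_isIso (yonedaRestrict F Y) (tensor W A)).comp
      (homObjEquiv W (restrict (F.comp V yoneda) (representable Y)) A).bijective
    rw [← Function.Bijective.of_comp_iff' h₁,
      ← Function.Bijective.of_comp_iff _ (homObjEquiv X Y A).bijective]
    apply iff_of_eq
    congr 1
    ext1 f
    exact (weightedComparison_yoneda F ξ Y f).trans (Category.assoc _ _ _).symm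
  constructor
  · intro h Y
    have := h Y
    -- The points at A = 𝟙 recover the unenriched universal property; conversely, cotensors upgrade
    -- that property to all A.
    have h₁ := (key Y (𝟙_ V)).1
      (bijective_postcomp_of_isIso (weightedComparison W (F.comp V yoneda) ξ Y) _)
    rw [← Function.Bijective.of_comp_iff' (bijective_precomp_of_isIso (tensorUnit W) _)]
    convert h₁.comp (bijective_precomp_of_isIso (tensorUnit X) Y) using 1
    ext1 f
    exact tensorUnit_comp_restrictMap F _ f
  · intro h Y
    exact isIso_of_yoneda_map_bijective _ fun A ↦
      (key Y A).2 (bijective_tensor_of_bijective F _ A h Y)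


theorem exists_isWeightedColimit [HasColimitsOfSize.{v, v} V] (W : VPresheaf V D) :
    ∃ ξ, IsWeightedColimit W (F.comp V yoneda) (extend F W) ξ := by
  refine ⟨extUnit F W ≫ inv (yonedaRestrict F _), ?_⟩
  rw [isWeightedColimit_iff, isIso_extHomDesc_iff]
  simpa using bijective_extUnit_comp F W

end Weighted

/-! #### Quillen functors between categories of presheaves -/

section CofreeRestrict

variable {V : Type u} [Category.{v} V] [MonoidalCategory V] [MonoidalClosed V]
  [HasColimitsOfSize.{v, v} V]
  {D C : Type v} [EnrichedCategory V D] [EnrichedCategory V C] (F : EnrichedFunctor V D C)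

theorem extensionAdjunction_homEquiv (W : VPresheaf V D) (X : VPresheaf V C) :
    (extensionAdjunction F).homEquiv W X = extEquiv F W X :=
  congrFun₂ (Adjunction.mkOfHomEquiv_homEquiv _) W X

/-- Precomposition with `F`, as a map from the restriction of a cofree presheaf to a cofree
presheaf. -/
abbrev cofreeRestrict (d : D) (Z : V) :
    restrict F (cofreeObj (F.obj d) Z) ⟶ cofreeObj d Z where
  app a := (MonoidalClosed.pre (F.map d a)).app Z
  naturality a b := by
    apply ihom_hom_ext
    simp only [MonoidalCategory.whiskerLeft_comp, Category.assoc]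
    rw [MonoidalClosed.id_tensor_pre_app_comp_ev, whiskerLeft_cofreeAct,
      whisker_exchange_assoc, whiskerLeft_cofreeAct, associator_inv_naturality_right_assoc,
      whisker_exchange_assoc (eComp V d a b), MonoidalClosed.id_tensor_pre_app_comp_ev,
      ← comp_whiskerRight_assoc (eComp V d a b), F.map_comp, 
      MonoidalCategory.tensorHom_def']
    simp

/-- The component of the unit at d and precomposition with F are mates, which is the hypothesis of
`IsLeftQuillen.weakEquivalence_iff_of_mates`. -/
theorem homEquiv_comp_cofreeRestrict (d : D) (W : VPresheaf V D) (Z : V)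
    (f : (extend F W).obj (F.obj d) ⟶ Z) :
    (cofreeAdjunction d).homEquiv W Z ((extUnit F W).app d ≫ f) =
      ((extensionAdjunction F).comp (cofreeAdjunction (F.obj d))).homEquiv W Z f ≫
        cofreeRestrict F d Z := by
  refine hom_ext fun a ↦ ?_
  have h : (((extensionAdjunction F).comp (cofreeAdjunction (F.obj d))).homEquiv W Z f).app a =
      (extUnit F W).app a ≫
        MonoidalClosed.curry ((extend F W).act (F.obj d) (F.obj a) ≫ f) := by
    rw [Adjunction.comp_homEquiv, ← cofreeAdjunction_homEquiv_app]
    exact congrArg (fun e ↦ Hom.app (e ((cofreeAdjunction (F.obj d)).homEquiv _ _ f)) a)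
      (extensionAdjunction_homEquiv F W (cofreeObj (F.obj d) Z))
  refine Eq.trans ?_ (congrArg (· ≫ (MonoidalClosed.pre (F.map d a)).app Z) h.symm)
  rw [cofreeAdjunction_homEquiv_app, Category.assoc, MonoidalClosed.curry_pre_app,
    ← MonoidalClosed.curry_natural_left, reassoc_of% (extUnit F W).naturality d a]

end CofreeRestrict

/-! ### Left Quillen functors on presheaves and the derived unit -/

section Quillen

variable {V : Type u} [Category.{v} V] [MonoidalCategory V] [MonoidalClosed V]
  [HasLimitsOfSize.{v, v} V] [HasColimitsOfSize.{v, v} V] [ModelCategory V]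
  [hV : Fact (IsCofibrantlyGenerated V)]
  {D C : Type v} [EnrichedCategory V D] [EnrichedCategory V C]
  [hD : Fact (IsLocallyFlat V D)] [hC : Fact (IsLocallyFlat V C)] (F : EnrichedFunctor V D C)

instance : ModelCategory (VPresheaf V C) := modelCategory V C hV.out hC.out

theorem isLeftQuillen_extension : IsLeftQuillen (extension F) :=
  .of_rightAdjoint (extensionAdjunction F)
    (fun _ _ p _ ↦ (fibration_iff_app _).2 fun d ↦ fibration_app p (F.obj d))
    fun _ _ p _ _ ↦ (weakEquivalence_iff_app _).2 fun d ↦ weakEquivalence_app p (F.obj d)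

theorem isLeftQuillen_evaluation (c : C) : IsLeftQuillen (evaluation V c) :=
  .of_rightAdjoint (cofreeAdjunction c) (fun _ _ p _ ↦ fibration_cofree_map hC.out c p)
    fun _ _ p _ _ ↦ weakEquivalence_cofree_map hC.out c p

theorem isLeftQuillen_free (c : C) : IsLeftQuillen (free (V := V) c) :=
  .of_rightAdjoint (freeAdjunction c) (fun _ _ p _ ↦ fibration_app p c)
    fun _ _ p _ _ ↦ weakEquivalence_app p c

theorem isLeftQuillen_tensorFunctor [SymmetricCategory V] [IsMonoidalModelCategory V] (A : V)
    [IsCofibrant A] : IsLeftQuillen (tensorFunctor C A) := by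
  have hA := (isFlatObject_of_isCofibrant A).isLeftQuillen
  refine .of_rightAdjoint (cotensorAdjunction C A)
    (fun _ _ p _ ↦ (fibration_iff_app _).2 fun c ↦ ?_)
    fun _ _ p _ _ ↦ (weakEquivalence_iff_app _).2 fun c ↦ ?_
  · exact hA.fibration_map (ihom.adjunction A) (p.app c)
  · exact hA.weakEquivalence_map_of_fibration (ihom.adjunction A) (p.app c)

variable [SymmetricCategory V] [IsMonoidalModelCategory V]

variable {F} in
-- Passing to mates turns the claim for cofibrant W into one for fibrant Z: precomposition with
-- F_{d,a}, a weak equivalence between flat objects, is a weak equivalence on internal homs into Z.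
theorem weakEquivalence_extUnit (hF : IsHomotopicallyFullyFaithful F) (W : VPresheaf V D)
    [IsCofibrant W] : WeakEquivalence (extUnit F W) := by
  refine (weakEquivalence_iff_app _).2 fun d ↦ ?_
  refine (IsLeftQuillen.weakEquivalence_iff_of_mates (cofreeAdjunction d)
    ((extensionAdjunction F).comp (cofreeAdjunction (F.obj d))) (isLeftQuillen_evaluation d)
    ((isLeftQuillen_extension F).comp (isLeftQuillen_evaluation (F.obj d)))
    (fun W ↦ (extUnit F W).app d) (cofreeRestrict F d)
    (homEquiv_comp_cofreeRestrict F d)).2 (fun Z _ ↦ ?_) W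
  refine (weakEquivalence_iff_app _).2 fun a ↦ ?_
  have := hF d a
  exact (hD.out d a).weakEquivalence_pre (hC.out _ _) (F.map d a) Z

end Quillen

end VPresheaf

/-! ### Objects local with respect to a map -/

section LocalObjects

variable {M H : Type*} [Category* M] [ModelCategory M] [Category* H] (L : M ⥤ H)
  [L.IsLocalization (weakEquivalences M)] {X Y : M} (p : X ⟶ Y)

/-- `T` is `p`-local if `p` induces a bijection between homotopy classes of maps out of `T`. -/
def IsLocalObject (T : M) : Prop :=
  Function.Bijective fun x : L.obj T ⟶ L.obj X ↦ x ≫ L.map p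

variable {L p} in
theorem isLocalObject_iff_of_weakEquivalence {T T' : M} (t : T ⟶ T')
    [WeakEquivalence t] : IsLocalObject L p T ↔ IsLocalObject L p T' := by
  have := isIso_map_of_weakEquivalence L t
  rw [IsLocalObject, IsLocalObject,
    ← Function.Bijective.of_comp_iff _ (bijective_precomp_of_isIso (L.map t) _),
    ← Function.Bijective.of_comp_iff' (bijective_precomp_of_isIso (L.map t) (L.obj Y))]
  apply iff_of_eq
  congr 1
  ext1 x
  simp

end LocalObjects

namespace VPresheaf

/-! ### Cofibrant replacement of representable presheaves -/

section FreeUnit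

variable {V : Type u} [Category.{v} V] [MonoidalCategory V] {C : Type w} [EnrichedCategory V C]

/-- The map `C(-, c) ⊗ Q ⟶ C(-, c)` induced by `q : Q ⟶ 𝟙`. -/
abbrev freeUnit (c : C) {Q : V} (q : Q ⟶ 𝟙_ V) :
    tensor (representable c) Q ⟶ representable c :=
  tensorMapRight (representable c) q ≫ tensorUnit (representable c)

variable [SymmetricCategory V] [MonoidalClosed V] [ModelCategory V] [IsMonoidalModelCategory V]

theorem weakEquivalence_freeUnit (hC : IsLocallyFlat V C) (c : C) {Q : V} [IsCofibrant Q] (q : Q ⟶ 𝟙_ V)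
    [WeakEquivalence q] : WeakEquivalence (freeUnit c q) := by
  refine (weakEquivalence_iff_app _).2 fun a ↦ ?_
  have := (hC a c).weakEquivalence_whiskerLeft q
  change WeakEquivalence ((a ⟶[V] c) ◁ q ≫ (ρ_ (a ⟶[V] c)).hom)
  infer_instance

/-- C(-, c) need not be cofibrant, so Ken Brown's lemma for `- ⊗ A` does not apply directly. Instead
the flat object C(a, c) is tensored with the weak equivalence Q ⊗ A → A of cofibrant objects. -/
theorem weakEquivalence_tensorMapLeft_freeUnit (hC : IsLocallyFlat V C) (c : C) {Q : V} [IsCofibrant Q] (q : Q ⟶ 𝟙_ V)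
    [WeakEquivalence q] (A : V) [IsCofibrant A] :
    WeakEquivalence (tensorMapLeft (freeUnit c q) A) := by
  refine (weakEquivalence_iff_app _).2 fun a ↦ ?_
  have : IsCofibrant (Q ⊗ A) :=
    (isFlatObject_of_isCofibrant Q).isLeftQuillen.isCofibrant (ihom.adjunction Q) A
  have := IsMonoidalModelCategory.weakEquivalence_unit q (K := A)
  have h : WeakEquivalence ((a ⟶[V] c) ◁ (q ▷ A ≫ (λ_ A).hom)) :=
    (hC a c).isLeftQuillen.weakEquivalence_map (q ▷ A ≫ (λ_ A).hom)
  have e : (tensorMapLeft (freeUnit c q) A).app a =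
      (α_ _ _ _).hom ≫ (a ⟶[V] c) ◁ (q ▷ A ≫ (λ_ A).hom) := by
    simp
  rw [e]
  infer_instance

end FreeUnit

/-! #### Quillen equivalences -/

section Characterization

variable {V : Type u} [Category.{v} V] [MonoidalCategory V] [MonoidalClosed V]
  [HasLimitsOfSize.{v, v} V] [HasColimitsOfSize.{v, v} V] [ModelCategory V]
  [hV : Fact (IsCofibrantlyGenerated V)]
  {D C : Type v} [EnrichedCategory V D] [EnrichedCategory V C]
  [hD : Fact (IsLocallyFlat V D)] [hC : Fact (IsLocallyFlat V C)] {F : EnrichedFunctor V D C}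

/-- The Quillen adjunction part is automatic, so only the condition on transposes remains. -/
theorem isQuillenEquivalence_iff : IsQuillenEquivalence (extensionAdjunction F) ↔
    ∀ (W : VPresheaf V D) (Y : VPresheaf V C) [IsCofibrant W] [IsFibrant Y]
      (g : W ⟶ restrict F Y), WeakEquivalence (extHomDesc g) ↔ WeakEquivalence g := by
  constructor
  · intro h W Y _ _ g
    have h₁ := h.weakEquivalence_iff W Y (extHomDesc g) inferInstance inferInstance
    have h₂ : (extensionAdjunction F).homEquiv W Y (extHomDesc g) = g := by
      rw [extensionAdjunction_homEquiv]
      exact (extEquiv F W Y).right_inv g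
    rw [h₂] at h₁
    exact h₁
  · intro h
    refine ⟨fun f _ ↦ (isLeftQuillen_extension F).cofibration f, fun f _ _ ↦
      ⟨(isLeftQuillen_extension F).cofibration f, (isLeftQuillen_extension F).weakEquivalence f⟩,
      fun W Y f _ _ ↦ ?_⟩
    rw [extensionAdjunction_homEquiv]
    refine Iff.trans (iff_of_eq ?_) (h W Y (extEquiv F W Y f))
    exact congrArg (fun x : extend F W ⟶ Y ↦ WeakEquivalence x) ((extEquiv F W Y).left_inv f).symm

/-- Under the derived adjunction, composing with p on maps out of F_! W becomes composing with the
isomorphism induced by F^* p. -/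
theorem isLocalObject_extend {H : Type*} [Category* H] (L : VPresheaf V C ⥤ H)
    [L.IsLocalization (weakEquivalences (VPresheaf V C))] {X Y : VPresheaf V C} [IsFibrant X]
    [IsFibrant Y] {p : X ⟶ Y} (h : WeakEquivalence (restrictMap F p)) (W : VPresheaf V D)
    [IsCofibrant W] : IsLocalObject L p (extend F W) := by
  have := isIso_map_of_weakEquivalence (weakEquivalences (VPresheaf V D)).Q (restrictMap F p)
  exact ((isLeftQuillen_extension F).bijective_postcomp_iff (extensionAdjunction F)
    (weakEquivalences (VPresheaf V D)).Q L W p).2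
    (bijective_postcomp_of_isIso ((weakEquivalences (VPresheaf V D)).Q.map (restrictMap F p)) _)

variable [SymmetricCategory V]

theorem isHomotopyAbsoluteColimit_of_isQuillenEquivalence
    (h : IsQuillenEquivalence (extensionAdjunction F)) (c : C) :
    IsHomotopyAbsoluteColimit F c := by
  rw [isQuillenEquivalence_iff] at h
  obtain ⟨R, _, r, _, _⟩ := FibrantObject.HoCat.exists_resolution (representable (V := V) c)
  obtain ⟨W, hW, g, _, _⟩ := CofibrantObject.HoCat.exists_resolution (restrict F R)
  obtain ⟨ξ, hξ⟩ := exists_isWeightedColimit F W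
  refine ⟨W, extend F W, ξ, hW, hξ, ?_⟩
  exact .trans _ R _ (.rel _ _ ⟨extHomDesc g, (h W R g).2 inferInstance⟩)
    (.symm _ _ (.rel _ _ ⟨r, inferInstance⟩))

variable [IsMonoidalModelCategory V]

theorem isHomotopicallyFullyFaithful_of_isQuillenEquivalence
    (h : IsQuillenEquivalence (extensionAdjunction F)) : IsHomotopicallyFullyFaithful F := by
  rw [isQuillenEquivalence_iff] at h
  intro d' d
  obtain ⟨Q, _, q, _, _⟩ := CofibrantObject.HoCat.exists_resolution (𝟙_ V)
  obtain ⟨R, _, r, _, _⟩ := FibrantObject.HoCat.exists_resolution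
    (representable (V := V) (F.obj d))
  have := weakEquivalence_freeUnit hC.out (F.obj d) q
  have hQ : IsCofibrant (tensor (representable (V := V) d) Q) :=
    (isLeftQuillen_free d).isCofibrant (freeAdjunction d) Q
  -- The transpose is C(-, F d) ⊗ Q → C(-, F d) → R preceded by the isomorphism from F_!(D(-, d) ⊗
  -- Q), hence a weak equivalence.
  have h₁ := (h _ _ (freeRestrict F d Q ≫ restrictMap F (freeUnit (F.obj d) q ≫ r))).1 (by
    rw [extHomDesc_comp]
    infer_instance)
  have h₂ := (hD.out d' d).weakEquivalence_whiskerLeft q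
  have e : (((d' ⟶[V] d) ◁ q ≫ (ρ_ _).hom) ≫ F.map d' d) ≫ r.app (F.obj d') =
      (freeRestrict F d Q ≫ restrictMap F (freeUnit (F.obj d) q ≫ r)).app d' := by
    simp [← whisker_exchange_assoc]
  have h₃ := weakEquivalence_app _ d' (hf := h₁)
  rw [← e] at h₃
  have := weakEquivalence_of_postcomp (((d' ⟶[V] d) ◁ q ≫ (ρ_ _).hom) ≫ F.map d' d)
    (r.app (F.obj d'))
  exact weakEquivalence_of_precomp ((d' ⟶[V] d) ◁ q ≫ (ρ_ _).hom) (F.map d' d)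

section Reflects

variable {H : Type*} [Category* H] (L : VPresheaf V C ⥤ H)
  [L.IsLocalization (weakEquivalences (VPresheaf V C))] {X Y : VPresheaf V C} (p : X ⟶ Y)

variable {L p} in
-- Any two cofibrant replacements of T compare with a third one whose map to T is a trivial
-- fibration, and tensoring with a cofibrant A preserves weak equivalences between cofibrant
-- presheaves.
theorem isLocalObject_tensor_iff {P P' T : VPresheaf V C} [IsCofibrant P] [IsCofibrant P']
    (q : P ⟶ T) (q' : P' ⟶ T) [WeakEquivalence q] [WeakEquivalence q'] (A : V) [IsCofibrant A] :
    IsLocalObject L p (tensor P A) ↔ IsLocalObject L p (tensor P' A) := by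
  obtain ⟨R, _, r, _, _⟩ := CofibrantObject.HoCat.exists_resolution T
  have key {P : VPresheaf V C} [IsCofibrant P] (q : P ⟶ T) [WeakEquivalence q] :
      IsLocalObject L p (tensor P A) ↔ IsLocalObject L p (tensor R A) := by
    have sq : CommSq (initial.to R) (initial.to P) r q := ⟨Subsingleton.elim _ _⟩
    have : WeakEquivalence sq.lift := weakEquivalence_of_postcomp_of_fac sq.fac_right
    have : WeakEquivalence (tensorMapLeft sq.lift A) :=
      (isLeftQuillen_tensorFunctor A).weakEquivalence_map sq.lift
    exact isLocalObject_iff_of_weakEquivalence (tensorMapLeft sq.lift A)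
  exact (key q).trans (key q').symm

/-- All objects `P ⊗ A` with `A` and `P` cofibrant and `P` weakly equivalent to `T` are
`p`-local. -/
def IsStablyLocalObject (T : VPresheaf V C) : Prop :=
  ∀ (P : VPresheaf V C) [IsCofibrant P] (q : P ⟶ T) [WeakEquivalence q] (A : V) [IsCofibrant A],
    IsLocalObject L p (tensor P A)

variable {L p} in
-- Quantifying over cofibrant replacements makes the notion homotopy invariant, although `- ⊗ A`
-- itself need not preserve all weak equivalences. It thus passes along zigzags.
theorem isStablyLocalObject_iff_of_weaklyEquivalent {T T' : VPresheaf V C}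
    (h : WeaklyEquivalent T T') : IsStablyLocalObject L p T ↔ IsStablyLocalObject L p T' := by
  induction h with
  | rel T T' h =>
    obtain ⟨t, _⟩ := h
    refine ⟨fun h P _ q _ A _ ↦ ?_, fun h P _ q _ A _ ↦ h P (q ≫ t) A⟩
    obtain ⟨R, _, r, _, _⟩ := CofibrantObject.HoCat.exists_resolution T
    exact (isLocalObject_tensor_iff q (r ≫ t) A).2 (h R r A)
  | refl => rfl
  | symm _ _ _ h => exact h.symm
  | trans _ _ _ _ _ h h' => exact h.trans h'

variable [IsFibrant X] [IsFibrant Y]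

variable {p} in
-- The weighted colimit is F_! W, which is cofibrant, and F_! W ⊗ A ≅ F_!(W ⊗ A) is local because W
-- ⊗ A is cofibrant.
theorem isStablyLocalObject_representable (h : WeakEquivalence (restrictMap F p)) {c : C}
    (hc : IsHomotopyAbsoluteColimit F c) : IsStablyLocalObject L p (representable c) := by
  obtain ⟨W, T, ξ, _, hξ, hT⟩ := hc
  rw [isWeightedColimit_iff] at hξ
  rw [← isStablyLocalObject_iff_of_weaklyEquivalent hT]
  intro P _ q _ A _
  have : IsCofibrant (extend F W) :=
    (isLeftQuillen_extension F).isCofibrant (extensionAdjunction F) W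
  rw [isLocalObject_tensor_iff q (extHomDesc (ξ ≫ yonedaRestrict F T)) A,
    ← isLocalObject_iff_of_weakEquivalence
      (extHomDesc (tensorMapLeft (extUnit F W) A ≫ restrictTensor F (extend F W) A))]
  have : IsCofibrant (tensor W A) :=
    (isLeftQuillen_tensorFunctor A).isCofibrant (cotensorAdjunction D A) W
  exact isLocalObject_extend L h _

variable {p} in
theorem weakEquivalence_of_weakEquivalence_restrictMap (h : WeakEquivalence (restrictMap F p))
    (hF : ∀ c, IsHomotopyAbsoluteColimit F c) : WeakEquivalence p := by
  refine (weakEquivalence_iff_app _).2 fun c ↦ ?_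
  let L := (weakEquivalences (VPresheaf V C)).Q
  obtain ⟨Q, _, q, _, _⟩ := CofibrantObject.HoCat.exists_resolution (𝟙_ V)
  have := weakEquivalence_freeUnit hC.out c q
  have : IsCofibrant (tensor (representable (V := V) c) Q) :=
    (isLeftQuillen_free c).isCofibrant (freeAdjunction c) Q
  -- Maps from A to the value at c are tested through C(-, c) ⊗ A, whose locality is inherited from
  -- the cofibrant replacement C(-, c) ⊗ Q ⊗ A.
  refine weakEquivalence_of_bijective_postcomp (weakEquivalences V).Q _ fun A _ ↦ ?_
  have := weakEquivalence_tensorMapLeft_freeUnit hC.out c q A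
  have h₁ := isStablyLocalObject_representable L h (hF c) _ (freeUnit c q) A
  rw [isLocalObject_iff_of_weakEquivalence (tensorMapLeft (freeUnit c q) A)] at h₁
  exact ((isLeftQuillen_free c).bijective_postcomp_iff (freeAdjunction c) _ L A p).1 h₁

end Reflects

theorem isQuillenEquivalence_of_isHomotopyAbsoluteColimit (hF : IsHomotopicallyFullyFaithful F)
    (hF' : ∀ c, IsHomotopyAbsoluteColimit F c) :
    IsQuillenEquivalence (extensionAdjunction F) := by
  have h {X Y : VPresheaf V C} (f : X ⟶ Y) [WeakEquivalence f] :
      WeakEquivalence (restrictMap F f) :=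
    (weakEquivalence_iff_app _).2 fun d ↦ weakEquivalence_app f (F.obj d)
  rw [isQuillenEquivalence_iff]
  intro W Y _ _ g
  have := weakEquivalence_extUnit hF W
  have e : extUnit F W ≫ restrictMap F (extHomDesc g) = g := (extEquiv F W Y).right_inv g
  constructor
  · intro _
    have := h (extHomDesc g)
    rw [← e]
    infer_instance
  · intro _
    -- F_! W need not be fibrant, whereas reflection is known only between fibrant presheaves. The
    -- factorization inserts an X which is fibrant because Y is.
    obtain ⟨X, i, p, _, _, _, e'⟩ : ∃ (X : VPresheaf V C) (i : extend F W ⟶ X) (p : X ⟶ Y),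
        Cofibration i ∧ WeakEquivalence i ∧ Fibration p ∧ i ≫ p = extHomDesc g := by
      have fac := MorphismProperty.factorizationData (trivialCofibrations (VPresheaf V C))
        (fibrations (VPresheaf V C)) (extHomDesc g)
      exact ⟨_, fac.i, fac.p, ⟨fac.hi.1⟩, ⟨fac.hi.2⟩, ⟨fac.hp⟩, fac.fac⟩
    have := isFibrant_of_fibration p
    have := h i
    have e'' : (extUnit F W ≫ restrictMap F i) ≫ restrictMap F p = g := by
      rw [← e, ← e', Category.assoc]
      rfl
    have := weakEquivalence_of_weakEquivalence_restrictMap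
      (weakEquivalence_of_precomp_of_fac e'') hF'
    rw [← e']
    infer_instance

end Characterization

end VPresheaf

end

theorem mainTheorem7 {V : Type u} [Category.{v} V] [MonoidalCategory V] [SymmetricCategory V]
    [MonoidalClosed V] [HasLimitsOfSize.{v, v} V] [HasColimitsOfSize.{v, v} V]
    [ModelCategory V] [IsMonoidalModelCategory V] (hV : IsCofibrantlyGenerated V)
    {D C : Type v} [EnrichedCategory V D] [EnrichedCategory V C]
    (hD : IsLocallyFlat V D) (hC : IsLocallyFlat V C) (F : EnrichedFunctor V D C) :
    IsQuillenEquivalence (VPresheaf.extensionAdjunction F) ↔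
      IsHomotopicallyFullyFaithful F ∧ ∀ c : C, IsHomotopyAbsoluteColimit F c := by
  have := Fact.mk hV
  have := Fact.mk hD
  have := Fact.mk hC
  exact ⟨fun h ↦ ⟨VPresheaf.isHomotopicallyFullyFaithful_of_isQuillenEquivalence h,
    VPresheaf.isHomotopyAbsoluteColimit_of_isQuillenEquivalence h⟩,
    fun h ↦ VPresheaf.isQuillenEquivalence_of_isHomotopyAbsoluteColimit h.1 h.2⟩
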